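/- Let $\Bbbk$ be an algebraically closed field of characteristic $0$ and let $H$ be a finite-dimensional Hopf algebra over $\Bbbk$ with comultiplication $\Delta(h)=\sum h_1\otimes h_2$, counit $\epsilon$ and antipode $S$. Let $H^*$ be the dual Hopf algebra and let $G(\cdot)$ denote the group of group-like elements. For $\chi\in H^*$ and $h\in H$ put $\chi\rightharpoonup h=\sum h_1\chi(h_2)$ and $h\leftharpoonup\chi=\sum\chi(h_1)h_2$. Let $D(H)$ be the Drinfel'd double of $H$: as a coalgebra $D(H)=(H^*)^{cop}\otimes H$, with product $$(f\otimes h)(g\otimes c)=\sum f\,(h_1\rightharpoonup g\leftharpoonup S^{-1}(h_3))\otimes h_2c,\qquad \langle a\rightharpoonup g\leftharpoonup b,\,y\rangle=\langle g,\,bya\rangle,$$ and unit $\epsilon\otimes 1$; write $fh$ for $f\otimes h$. Its standard universal $\mathcal R$-matrix is $\mathcal R=\sum_i(\epsilon\otimes e_i)\otimes(e^i\otimes 1)$, where $(e_i)$ is a basis of $H$ with dual basis $(e^i)$. A quasitriangular Hopf algebra is a pair $(A,R)$ of a Hopf algebra $A$ and an invertible $R\in A\otimes A$ with $(\Delta\otimes\mathrm{id})(R)=R_{13}R_{23}$,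 $(\mathrm{id}\otimes\Delta)(R)=R_{13}R_{12}$ and $\Delta^{op}(h)R=R\Delta(h)$ for all $h\in A$. It is called factorizable if the map $A^*\to A$, $a\mapsto(a\otimes\mathrm{id})(R_{21}R)$, is a linear isomorphism. **Theorem.** Let $n$ be odd and let $x\in G(H)$ have order $n$. Suppose that $a_1,\dots,a_m\in H$, $\chi\in G(H^*)$ and permutations $\sigma,\tau\in S_m$ satisfy (i) $xa_i=a_{\sigma(i)}x$ for all $i$, and $\{a_ix^j\mid 1\le i\le m,\ 1\le j\le n\}$ is a linear basis of $H$; (ii) $a_i\leftharpoonup\chi=a_{\tau^{-1}(i)}$ and $\chi\rightharpoonup a_i=a_{\tau^{-1}(\sigma^{-1}(i))}$ for all $i$; (iii) $\chi(x)$ is a primitive $n$-th root of unity, and $\chi$ has order $n$ in $G(H^*)$. Then $\chi x$ is a central group-like element of $D(H)$. The subalgebra $\langle\chi x\rangle$ generated by $\chi x$ and its inverse is a normal Hopf subalgebra of $D(H)$, that is, a Hopf subalgebra $K$ with $\sum h_1zS(h_2)\in K$ and $\sum S(h_1)zh_2\in K$ for all $h\in D(H)$, $z\in K$. The left ideal $I=D(H)\langle\chi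 x\rangle^+$, where $\langle\chi x\rangle^+=\langle\chi x\rangle\cap\ker\epsilon$, is a two-sided Hopf ideal. Finally, $(D(H)/I,\overline{\mathcal R})$ is a factorizable Hopf algebra, where $\overline{\mathcal R}$ is the image of $\mathcal R$ in $D(H)/I\otimes D(H)/I$. -/

import Mathlib

open scoped TensorProduct
open Coalgebra HopfAlgebra WithConv

/-! ### Matrix coefficients and bijectivity of the antipode -/

namespace DoubleAux

section coeff
variable {k : Type*} {C : Type*} [Field k] [AddCommGroup C] [Module k C]

/-- A family of matrix coefficients of a coalgebra: a finite basis `b`, with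
`Δ (b i) = ∑ j, t i j ⊗ b j`. Its entries span the coalgebra. -/
structure Coeff (k : Type*) (C : Type*) [Field k] [AddCommGroup C] [Module k C] [Coalgebra k C]
    (n : ℕ) where
  b : Module.Basis (Fin n) k C
  t : Fin n → Fin n → C
  comul_b : ∀ i, comul (R := k) (b i) = ∑ j, t i j ⊗ₜ[k] b j
  comul_t : ∀ i j, comul (R := k) (t i j) = ∑ l, t i l ⊗ₜ[k] t l j
  counit_t : ∀ i j, counit (R := k) (t i j) = if i = j then 1 else 0
  b_eq : ∀ i, b i = ∑ j, counit (R := k) (b j) • t i j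

theorem exists_coeff [Coalgebra k C] [FiniteDimensional k C] : ∃ n, Nonempty (Coeff k C n) := by
  classical
  let b := Module.finBasis k C
  let r : ∀ j, C ⊗[k] C →ₗ[k] C :=
    fun j => (TensorProduct.rid k C).toLinearMap ∘ₗ (b.coord j).lTensor C
  have hr : ∀ j x y, r j (x ⊗ₜ y) = b.coord j y • x := fun j x y => by simp [r]
  have hz : ∀ z : C ⊗[k] C, z = ∑ j, r j z ⊗ₜ[k] b j := by
    intro z
    induction z using TensorProduct.induction_on with
    | zero => simp
    | tmul x y =>
      simp only [hr, TensorProduct.smul_tmul, ← TensorProduct.tmul_sum]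
      congr 1
      exact (b.sum_repr y).symm
    | add x y hx hy =>
      nth_rewrite 1 [hx, hy]
      simp only [map_add, TensorProduct.add_tmul, Finset.sum_add_distrib]
  have h1 : ∀ i, comul (R := k) (b i) = ∑ j, r j (comul (R := k) (b i)) ⊗ₜ[k] b j :=
    fun i => hz _
  refine ⟨_, ⟨⟨b, fun i j => r j (comul (R := k) (b i)), h1, ?_, ?_, ?_⟩⟩⟩
  · intro i j
    have h := coassoc_apply (R := k) (b i)
    rw [h1 i] at h
    simp only [map_sum, LinearMap.rTensor_tmul, LinearMap.lTensor_tmul] at h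
    have h' := congrArg (fun z => ((TensorProduct.rid k C).toLinearMap.lTensor C ∘ₗ
      ((b.coord j).lTensor C).lTensor C) z) h
    have e : ∀ (z : C ⊗[k] C) (y : C), ((TensorProduct.rid k C).toLinearMap.lTensor C ∘ₗ
      ((b.coord j).lTensor C).lTensor C) (TensorProduct.assoc k C C C (z ⊗ₜ y)) =
        b.coord j y • z := by
      intro z y
      induction z using TensorProduct.induction_on with
      | zero => simp
      | tmul x y => simp
      | add x y hx hy => rw [TensorProduct.add_tmul, map_add, map_add, hx, hy, smul_add]
    simp only [map_sum, e] at h'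
    rw [Finset.sum_eq_single j] at h'
    · rw [Module.Basis.coord_apply, Module.Basis.repr_self, Finsupp.single_eq_same, one_smul] at h'
      rw [h']
      refine Finset.sum_congr rfl fun l _ => ?_
      simp [r]
    · intro l _ hl
      simp [Finsupp.single_eq_of_ne hl.symm, Module.Basis.coord_apply]
    · simp
  · intro i j
    have h := rTensor_counit_comul (R := k) (b i)
    rw [h1 i] at h
    have h' := congrArg (fun z => b.coord j (TensorProduct.lid k C z)) h
    simp only [map_sum, LinearMap.rTensor_tmul, TensorProduct.lid_tmul, map_smul, one_smul,
      Module.Basis.coord_apply, Module.Basis.repr_self] at h'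
    rw [Finset.sum_eq_single j] at h'
    · simpa [Finsupp.single_apply] using h'
    · intro l _ hl
      simp [hl]
    · simp
  · intro i
    have h := lTensor_counit_comul (R := k) (b i)
    rw [h1 i] at h
    have h' := congrArg (fun z => TensorProduct.rid k C z) h
    simpa using h'.symm

theorem Coeff.ext [Coalgebra k C] {n : ℕ} (T : Coeff k C n) {M : Type*} [AddCommMonoid M]
    [Module k M] {f g : C →ₗ[k] M} (h : ∀ i j, f (T.t i j) = g (T.t i j)) : f = g := by
  refine T.b.ext fun i => ?_
  rw [T.b_eq]
  simp [h]

end coeff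

section hopf
variable {k : Type*} {H : Type*} [Field k] [Ring H] [HopfAlgebra k H]
variable {n : ℕ} (T : Coeff k H n)

theorem Coeff.S_mul (i j : Fin n) :
    ∑ l, antipode k (T.t i l) * T.t l j = if i = j then 1 else 0 := by
  have h := mul_antipode_rTensor_comul_apply (R := k) (T.t i j)
  rw [T.comul_t, T.counit_t] at h
  simp only [map_sum, LinearMap.rTensor_tmul, LinearMap.mul'_apply] at h
  rw [h]; split_ifs <;> simp

theorem Coeff.mul_S (i j : Fin n) :
    ∑ l, T.t i l * antipode k (T.t l j) = if i = j then 1 else 0 := by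
  have h := mul_antipode_lTensor_comul_apply (R := k) (T.t i j)
  rw [T.comul_t, T.counit_t] at h
  simp only [map_sum, LinearMap.lTensor_tmul, LinearMap.mul'_apply] at h
  rw [h]; split_ifs <;> simp

theorem Coeff.S_mul_b (i : Fin n) :
    ∑ l, antipode k (T.t i l) * T.b l = algebraMap k H (counit (R := k) (T.b i)) := by
  have h := mul_antipode_rTensor_comul_apply (R := k) (T.b i)
  rw [T.comul_b] at h
  simpa only [map_sum, LinearMap.rTensor_tmul, LinearMap.mul'_apply] using h

theorem matrix_inv_unique {R : Type*} [Ring R] {X Y Z : Fin n → Fin n → R}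
    (h1 : ∀ i j, ∑ l, Y i l * X l j = if i = j then 1 else 0)
    (h2 : ∀ i j, ∑ l, X i l * Z l j = if i = j then 1 else 0) (i j : Fin n) : Y i j = Z i j := by
  have hYX : Matrix.of Y * Matrix.of X = 1 := by
    ext i j; simp only [Matrix.mul_apply, Matrix.of_apply, Matrix.one_apply, h1]
  have hXZ : Matrix.of X * Matrix.of Z = 1 := by
    ext i j; simp only [Matrix.mul_apply, Matrix.of_apply, Matrix.one_apply, h2]
  have h : Matrix.of Y = Matrix.of Z := left_inv_eq_right_inv hYX hXZ
  exact congrFun (congrFun h i) j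

theorem Coeff.comul_S (i j : Fin n) :
    comul (R := k) (antipode k (T.t i j)) =
      ∑ l, antipode k (T.t l j) ⊗ₜ[k] antipode k (T.t i l) := by
  refine matrix_inv_unique (X := fun i j => comul (R := k) (T.t i j))
    (Y := fun i j => comul (R := k) (antipode k (T.t i j)))
    (Z := fun i j => ∑ l, antipode k (T.t l j) ⊗ₜ[k] antipode k (T.t i l)) ?_ ?_ i j
  · intro i j
    simp only [← Bialgebra.comul_mul, ← map_sum, T.S_mul]
    split_ifs <;> simp
  · intro i j
    simp only [T.comul_t, Finset.sum_mul_sum, Algebra.TensorProduct.tmul_mul_tmul]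
    calc _ = ∑ a, ∑ b, (T.t i a * antipode k (T.t b j)) ⊗ₜ[k]
          ∑ c, T.t a c * antipode k (T.t c b) := by
          simp only [TensorProduct.tmul_sum]
          rw [Finset.sum_comm]
          refine Finset.sum_congr rfl fun a _ => Finset.sum_comm
      _ = _ := by
          simp only [T.mul_S]
          calc _ = ∑ a, (T.t i a * antipode k (T.t a j)) ⊗ₜ[k] (1 : H) := by
                refine Finset.sum_congr rfl fun a _ => ?_
                rw [Finset.sum_eq_single a]
                · simp
                · intro b _ hb; simp [hb.symm]
                · simp
            _ = _ := by
                rw [← TensorProduct.sum_tmul, T.mul_S]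
                split_ifs <;> simp [Algebra.TensorProduct.one_def]

/-- `hit f x = ∑ f(x₂) x₁`. -/
noncomputable def hit (f : H →ₗ[k] k) : H →ₗ[k] H :=
  (TensorProduct.rid k H).toLinearMap ∘ₗ f.lTensor H ∘ₗ comul

theorem hit_t (f : H →ₗ[k] k) (i j : Fin n) : hit f (T.t i j) = ∑ l, f (T.t l j) • T.t i l := by
  simp [hit, T.comul_t]

theorem hit_b (f : H →ₗ[k] k) (i : Fin n) : hit f (T.b i) = ∑ l, f (T.b l) • T.t i l := by
  simp [hit, T.comul_b]

theorem hit_hit (f g : H →ₗ[k] k) (x : H) (T : Coeff k H n) :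
    hit g (hit f x) = hit (g ∘ₗ hit f) x := by
  suffices h : hit g ∘ₗ hit f = hit (g ∘ₗ hit f) from LinearMap.congr_fun h x
  refine T.ext fun i j => ?_
  simp only [LinearMap.comp_apply, hit_t, map_sum, map_smul, Finset.smul_sum, Finset.sum_smul,
    smul_smul, smul_eq_mul]
  rw [Finset.sum_comm]

theorem counit_hit (f : H →ₗ[k] k) (x : H) (T : Coeff k H n) :
    counit (R := k) (hit f x) = f x := by
  suffices h : counit ∘ₗ hit f = f from LinearMap.congr_fun h x
  refine T.ext fun i j => ?_
  simp [hit_t, T.counit_t]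

theorem hit_coord (i : Fin n) (x : H) :
    hit (T.b.coord i) x = ∑ m, T.b.coord m x • T.t m i := by
  suffices h : hit (T.b.coord i) = ∑ m, (T.b.coord m).smulRight (T.t m i) by simp [h]
  refine T.b.ext fun j => ?_
  rw [hit_b]
  simp [Finsupp.single_apply]

/-- The functional `a ↦ ∑ i, bⁱ (hit f (a * S² (b i)))`. -/
noncomputable def intg (f : H →ₗ[k] k) : H →ₗ[k] k :=
  ∑ i, T.b.coord i ∘ₗ hit f ∘ₗ LinearMap.mulRight k (antipode k (antipode k (T.b i)))

theorem intg_apply (f : H →ₗ[k] k) (a : H) : intg T f a =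
    ∑ i, T.b.coord i (hit f (a * antipode k (antipode k (T.b i)))) := by
  simp [intg]

theorem SS_S (i j : Fin n) : ∑ l, antipode k (antipode k (T.t l j)) * antipode k (T.t i l) =
    if i = j then 1 else 0 := by
  simp only [← antipode_mul_antidistrib, ← map_sum, T.mul_S]
  split_ifs <;> simp

theorem comul_SS (i : Fin n) : comul (R := k) (antipode k (antipode k (T.b i))) =
    ∑ l, antipode k (antipode k (T.t i l)) ⊗ₜ[k] antipode k (antipode k (T.b l)) := by
  have h : ∀ i j, comul (R := k) (antipode k (antipode k (T.t i j))) =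
      ∑ l, antipode k (antipode k (T.t i l)) ⊗ₜ[k] antipode k (antipode k (T.t l j)) := by
    intro i j
    have e : (comul (R := k) : H →ₗ[k] _) ∘ₗ antipode k =
        TensorProduct.map (antipode k) (antipode k) ∘ₗ (TensorProduct.comm k H H).toLinearMap ∘ₗ
          comul := T.ext fun i j => by simp [T.comul_S, T.comul_t]
    have e' := LinearMap.congr_fun e (antipode k (T.t i j))
    simp only [LinearMap.comp_apply] at e'
    rw [e', T.comul_S]
    simp
  rw [T.b_eq]
  simp only [map_sum, map_smul, h, Finset.smul_sum]
  rw [Finset.sum_comm]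
  refine Finset.sum_congr rfl fun l _ => ?_
  conv_rhs => rw [T.b_eq]
  simp [TensorProduct.tmul_sum]

theorem hit_intg (f : H →ₗ[k] k) (a : H) : hit (intg T f) a = intg T f a • (1 : H) := by
  suffices h : hit (intg T f) = (intg T f).smulRight (1 : H) from LinearMap.congr_fun h a
  refine T.ext fun p q => ?_
  rw [hit_t, LinearMap.smulRight_apply, intg_apply]
  have key : ∀ (g : H →ₗ[k] k) (m : Fin n),
      hit g (T.t p q * antipode k (antipode k (T.b m))) =
      ∑ r, ∑ l, g (T.t r q * antipode k (antipode k (T.b l))) •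
        (T.t p r * antipode k (antipode k (T.t m l))) := by
    intro g m
    simp only [hit, LinearMap.comp_apply, Bialgebra.comul_mul, T.comul_t, comul_SS,
      Finset.sum_mul_sum, Algebra.TensorProduct.tmul_mul_tmul, map_sum]
    simp
  calc _ = ∑ r, ∑ i, ∑ l, T.b.coord i (hit f (T.t r q * antipode k (antipode k (T.b l)))) •
        (T.t p r * ∑ m, antipode k (antipode k (T.t m l)) * antipode k (T.t i m)) := by
        refine Finset.sum_congr rfl fun r _ => ?_
        rw [intg_apply, Finset.sum_smul]
        refine Finset.sum_congr rfl fun i _ => ?_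
        rw [Finset.sum_eq_single i]
        · rw [SS_S]; simp
        · intro l _ hl; rw [SS_S]; simp [hl.symm]
        · simp
    _ = ∑ i, ∑ m, (∑ r, ∑ l, T.b.coord i (hit f (T.t r q * antipode k (antipode k (T.b l)))) •
        (T.t p r * antipode k (antipode k (T.t m l)))) * antipode k (T.t i m) := by
        simp only [Finset.mul_sum, Finset.smul_sum, Finset.sum_mul, smul_mul_assoc, mul_assoc]
        rw [Finset.sum_comm]
        refine Finset.sum_congr rfl fun i _ => ?_
        conv_rhs => rw [Finset.sum_comm]
        refine Finset.sum_congr rfl fun r _ => ?_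
        rw [Finset.sum_comm]
    _ = ∑ i, ∑ m, (∑ r, T.b.coord r (hit f (T.t p q * antipode k (antipode k (T.b m)))) •
        T.t r i) * antipode k (T.t i m) := by
        refine Finset.sum_congr rfl fun i _ => Finset.sum_congr rfl fun m _ => ?_
        rw [← hit_coord, hit_hit _ _ _ T, key]
        rfl
    _ = ∑ m, ∑ r, T.b.coord r (hit f (T.t p q * antipode k (antipode k (T.b m)))) •
        ∑ i, T.t r i * antipode k (T.t i m) := by
        simp only [Finset.smul_sum, Finset.sum_mul, smul_mul_assoc]
        rw [Finset.sum_comm]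
        refine Finset.sum_congr rfl fun i _ => ?_
        rw [Finset.sum_comm]
    _ = _ := by
        rw [Finset.sum_smul]
        refine Finset.sum_congr rfl fun m _ => ?_
        rw [Finset.sum_eq_single m]
        · rw [T.mul_S]; simp
        · intro l _ hl; rw [T.mul_S]; simp [hl]
        · simp

theorem sum_intg (f : H →ₗ[k] k) (a : H) :
    ∑ j, intg T (T.b.coord j ∘ₗ hit f) (a * antipode k (T.b j)) = f a := by
  calc _ = ∑ j, ∑ i, ∑ m, T.b.coord m (hit f (a * antipode k
        ((T.b.coord i (T.t m j) • antipode k (T.b i)) * T.b j))) := by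
        refine Finset.sum_congr rfl fun j _ => ?_
        rw [intg_apply]
        refine Finset.sum_congr rfl fun i _ => ?_
        rw [← hit_hit _ _ _ T, hit_coord, mul_assoc, ← antipode_mul_antidistrib]
        simp [mul_comm]
    _ = ∑ m, T.b.coord m (hit f (a * antipode k (∑ j, antipode k
          (∑ i, T.b.coord i (T.t m j) • T.b i) * T.b j))) := by
        simp only [map_sum, Finset.mul_sum, Finset.sum_mul, map_smul]
        conv_rhs => rw [Finset.sum_comm]
        refine Finset.sum_congr rfl fun j _ => ?_
        rw [Finset.sum_comm]
    _ = ∑ m, counit (R := k) (T.b m) • T.b.coord m (hit f a) := by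
        refine Finset.sum_congr rfl fun m _ => ?_
        have e : ∀ j, ∑ i, T.b.coord i (T.t m j) • T.b i = T.t m j := fun j => T.b.sum_repr _
        simp only [e, T.S_mul_b, Algebra.algebraMap_eq_smul_one, map_smul, antipode_one, mul_smul_comm, mul_one]
    _ = counit (R := k) (∑ m, T.b.coord m (hit f a) • T.b m) := by
        simp only [map_sum, map_smul, smul_eq_mul, mul_comm]
    _ = _ := by
        rw [← counit_hit f a T]
        congr 1
        exact T.b.sum_repr _

theorem antipode_injective [FiniteDimensional k H] : Function.Injective (antipode k : H →ₗ[k] H) := by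
  obtain ⟨n, ⟨T⟩⟩ := exists_coeff (k := k) (C := H)
  rw [← LinearMap.ker_eq_bot, LinearMap.ker_eq_bot']
  intro v hv
  by_cases hint : ∀ f, intg T f = 0
  · have h0 : ∀ f : H →ₗ[k] k, f v = 0 := fun f => by rw [← sum_intg T f v]; simp [hint]
    exact (Module.forall_dual_apply_eq_zero_iff k v).1 h0
  push Not at hint
  obtain ⟨f, hf⟩ := hint
  have hl : ∀ a, hit (intg T f) a = intg T f a • (1 : H) := hit_intg T f
  generalize intg T f = lam at hf hl
  obtain ⟨a₀, ha₀⟩ : ∃ a, lam a ≠ 0 := by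
    by_contra! h
    exact hf (LinearMap.ext h)
  have hstar : ∀ p q i, ∑ j, lam (T.t p q * antipode k (T.t i j)) • T.b j =
      ∑ r, lam (T.t r q * antipode k (T.b i)) • T.t p r := by
    intro p q i
    calc _ = ∑ j, hit lam (T.t p q * antipode k (T.t i j)) * T.b j := by simp [hl]
      _ = ∑ j, ∑ r, ∑ l, lam (T.t r q * antipode k (T.t i l)) •
          (T.t p r * antipode k (T.t l j)) * T.b j := by
          refine Finset.sum_congr rfl fun j _ => ?_
          simp only [hit, LinearMap.comp_apply, Bialgebra.comul_mul, T.comul_t, T.comul_S,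
            Finset.sum_mul_sum, Algebra.TensorProduct.tmul_mul_tmul, map_sum]
          simp [Finset.sum_mul]
      _ = ∑ r, ∑ l, lam (T.t r q * antipode k (T.t i l)) •
          (T.t p r * ∑ j, antipode k (T.t l j) * T.b j) := by
          simp only [Finset.mul_sum, Finset.smul_sum, smul_mul_assoc, mul_assoc]
          rw [Finset.sum_comm]
          refine Finset.sum_congr rfl fun j _ => ?_
          rw [Finset.sum_comm]
      _ = _ := by
          refine Finset.sum_congr rfl fun r _ => ?_
          rw [T.b_eq i]
          simp only [T.S_mul_b, map_sum, map_smul, Finset.mul_sum, mul_smul_comm, Finset.sum_smul,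
            Algebra.algebraMap_eq_smul_one, smul_smul, mul_one, smul_eq_mul]
          simp [mul_comm]
  let c : Fin n → k := fun i => T.b.repr v i
  have hvc : v = ∑ i, c i • T.b i := (T.b.sum_repr v).symm
  have hw : ∀ j p q, ∑ i, c i * lam (T.t p q * antipode k (T.t i j)) = 0 := by
    intro j p q
    have h1 : ∑ j, (∑ i, c i * lam (T.t p q * antipode k (T.t i j))) • T.b j = 0 := by
      calc _ = ∑ i, c i • ∑ j, lam (T.t p q * antipode k (T.t i j)) • T.b j := by
            simp only [Finset.sum_smul, Finset.smul_sum, smul_smul]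
            rw [Finset.sum_comm]
        _ = ∑ r, lam (T.t r q * antipode k v) • T.t p r := by
            simp only [hstar, hvc, map_sum, map_smul, Finset.smul_sum, Finset.mul_sum,
              Finset.sum_smul, mul_smul_comm, smul_smul, smul_eq_mul]
            rw [Finset.sum_comm]
        _ = 0 := by simp [hv]
    have := Fintype.linearIndependent_iff.1 T.b.linearIndependent _ h1
    exact this j
  have hw' : ∀ a j, ∑ i, c i * lam (a * antipode k (T.t i j)) = 0 := by
    intro a j
    have : ∑ i, c i • (lam ∘ₗ LinearMap.mulRight k (antipode k (T.t i j))) = 0 :=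
      T.ext fun p q => by simpa using hw j p q
    simpa using LinearMap.congr_fun this a
  have hc : ∀ j, c j = 0 := by
    intro j
    have h2 : ∑ l, ∑ i, c i * lam (a₀ * antipode k (antipode k (T.t l j)) * antipode k (T.t i l)) = 0 :=
      Finset.sum_eq_zero fun l _ => hw' _ _
    rw [Finset.sum_comm] at h2
    simp only [← Finset.mul_sum, ← map_sum, mul_assoc, SS_S] at h2
    rw [Finset.sum_eq_single j] at h2
    · simpa [ha₀] using h2
    · intro i _ hi; simp [hi]
    · simp
  rw [hvc]; simp [hc]

theorem antipode_bijective [FiniteDimensional k H] :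
    Function.Bijective (antipode k : H →ₗ[k] H) :=
  ⟨antipode_injective, (LinearMap.injective_iff_surjective).1 antipode_injective⟩

end hopf
end DoubleAux

/-! ### The dual Hopf algebra -/

/-- The dual `H^*`, an algebra under the convolution product `(f g)(c) = ∑ f(c₁) g(c₂)`. -/
def HopfDual (k : Type*) (H : Type*) [Field k] [Ring H] [HopfAlgebra k H] : Type _ :=
  WithConv (H →ₗ[k] k)

namespace HopfDual
variable {k : Type*} {H : Type*} [Field k] [Ring H] [HopfAlgebra k H]

noncomputable instance : Ring (HopfDual k H) := inferInstanceAs (Ring (WithConv (H →ₗ[k] k)))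

noncomputable instance : Algebra k (HopfDual k H) :=
  inferInstanceAs (Algebra k (WithConv (H →ₗ[k] k)))

instance : FunLike (HopfDual k H) H k where
  coe f := f.ofConv
  coe_injective _ _ h := WithConv.ext (DFunLike.coe_injective h)

instance : LinearMapClass (HopfDual k H) k H k where
  map_add f := f.ofConv.map_add
  map_smulₛₗ f := f.ofConv.map_smul

variable (k H) in
/-- The underlying vector space of `HopfDual k H` is the dual space of `H`. -/
noncomputable def toDual : HopfDual k H ≃ₗ[k] Module.Dual k H where
  toFun f := f.ofConv
  invFun f := toConv f
  left_inv _ := rfl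
  right_inv _ := rfl
  map_add' _ _ := rfl
  map_smul' _ _ := rfl

@[simp] theorem toDual_apply (f : HopfDual k H) (c : H) : toDual k H f c = f c := rfl

@[simp] theorem toDual_symm_apply (f : Module.Dual k H) (c : H) :
    (toDual k H).symm f c = f c := rfl

@[ext] theorem ext {f g : HopfDual k H} (h : ∀ c, f c = g c) : f = g := DFunLike.ext _ _ h

@[simp] theorem zero_apply (c : H) : (0 : HopfDual k H) c = 0 := rfl

@[simp] theorem add_apply (f g : HopfDual k H) (c : H) : (f + g) c = f c + g c := rfl

@[simp] theorem smul_apply (r : k) (f : HopfDual k H) (c : H) : (r • f) c = r * f c := rfl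

@[simp] theorem one_apply (c : H) : (1 : HopfDual k H) c = counit (R := k) c := rfl

theorem mul_apply (f g : HopfDual k H) (c : H) : (f * g) c =
    LinearMap.mul' k k (TensorProduct.map (toDual k H f) (toDual k H g) (comul c)) := rfl

/-- Evaluation `f ↦ f c`. -/
noncomputable def eval (c : H) : HopfDual k H →ₗ[k] k :=
  LinearMap.applyₗ c ∘ₗ (toDual k H).toLinearMap

@[simp] theorem eval_apply (c : H) (f : HopfDual k H) : eval c f = f c := rfl

@[simp] theorem sum_apply {ι : Type*} (s : Finset ι) (f : ι → HopfDual k H) (c : H) :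
    (∑ i ∈ s, f i) c = ∑ i ∈ s, f i c := map_sum (eval c) f s

theorem algebraMap_apply (r : k) (c : H) :
    algebraMap k (HopfDual k H) r c = r * counit (R := k) c := by
  rw [Algebra.algebraMap_eq_smul_one, smul_apply, one_apply]

instance finiteDimensional [FiniteDimensional k H] : FiniteDimensional k (HopfDual k H) :=
  (toDual k H).symm.finiteDimensional

/-- Evaluation of the first leg -/
noncomputable def evalLeft {M : Type*} [AddCommGroup M] [Module k M] (c : H) :
    HopfDual k H ⊗[k] M →ₗ[k] M :=
  (TensorProduct.lid k M).toLinearMap ∘ₗ (eval c).rTensor M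

@[simp] theorem evalLeft_tmul {M : Type*} [AddCommGroup M] [Module k M] (c : H)
    (f : HopfDual k H) (m : M) : evalLeft c (f ⊗ₜ[k] m) = f c • m := by
  simp [evalLeft]

theorem tensor_ext [FiniteDimensional k H] {M : Type*} [AddCommGroup M] [Module k M]
    {z z' : HopfDual k H ⊗[k] M} (h : ∀ c, evalLeft c z = evalLeft c z') : z = z' := by
  let b := Module.finBasis k H
  have e : ∀ z : HopfDual k H ⊗[k] M, z = ∑ i, (toDual k H).symm (b.coord i) ⊗ₜ[k] evalLeft (b i) z := by
    intro z
    induction z using TensorProduct.induction_on with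
    | zero => simp
    | tmul f m =>
      simp only [evalLeft_tmul, ← TensorProduct.smul_tmul, ← TensorProduct.sum_tmul]
      congr 1
      apply (toDual k H).injective
      refine b.ext fun j => ?_
      simp [Finsupp.single_apply]
    | add x y hx hy =>
      nth_rewrite 1 [hx, hy]
      simp only [map_add, TensorProduct.tmul_add, Finset.sum_add_distrib]
  rw [e z, e z']
  simp only [h]

/-- The pairing `f ⊗ g ↦ (c ⊗ d ↦ f c * g d)`. -/
noncomputable def dualTensorEquiv [FiniteDimensional k H] :
    HopfDual k H ⊗[k] HopfDual k H ≃ₗ[k] Module.Dual k (H ⊗[k] H) :=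
  TensorProduct.congr (toDual k H) (toDual k H) ≪≫ₗ
    TensorProduct.dualDistribEquiv k H H

theorem dualTensorEquiv_tmul [FiniteDimensional k H] (f g : HopfDual k H) (c d : H) :
    dualTensorEquiv (f ⊗ₜ[k] g) (c ⊗ₜ[k] d) = f c * g d := by
  simp [dualTensorEquiv]

theorem dualTensorEquiv_eval [FiniteDimensional k H] (z : HopfDual k H ⊗[k] HopfDual k H)
    (c d : H) : dualTensorEquiv z (c ⊗ₜ[k] d) = evalLeft c z d := by
  induction z using TensorProduct.induction_on with
  | zero => simp
  | tmul f g => simp [dualTensorEquiv_tmul]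
  | add x y hx hy => simp [hx, hy]

theorem evalLeft_lTensor {M N : Type*} [AddCommGroup M] [Module k M] [AddCommGroup N] [Module k N]
    (φ : M →ₗ[k] N) (c : H) (z : HopfDual k H ⊗[k] M) :
    evalLeft c (φ.lTensor _ z) = φ (evalLeft c z) := by
  induction z using TensorProduct.induction_on with
  | zero => simp
  | tmul f g => simp
  | add x y hx hy => simp [hx, hy]

noncomputable instance [FiniteDimensional k H] : CoalgebraStruct k (HopfDual k H) where
  comul := dualTensorEquiv.symm.toLinearMap ∘ₗ (LinearMap.mul' k H).dualMap ∘ₗ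
    (toDual k H).toLinearMap
  counit := eval 1

variable [FiniteDimensional k H]

theorem counit_apply (f : HopfDual k H) : counit (R := k) f = f 1 := rfl

theorem dualTensorEquiv_comul (f : HopfDual k H) (c d : H) :
    dualTensorEquiv (comul (R := k) f) (c ⊗ₜ[k] d) = f (c * d) := by
  change dualTensorEquiv (dualTensorEquiv.symm _) _ = _
  rw [LinearEquiv.apply_symm_apply]
  rfl

theorem evalLeft_comul (f : HopfDual k H) (c d : H) :
    evalLeft c (comul (R := k) f) d = f (c * d) := by
  rw [← dualTensorEquiv_eval, dualTensorEquiv_comul]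

theorem evalLeft_comul' (f : HopfDual k H) (c : H) :
    evalLeft c (comul (R := k) f) = (toDual k H).symm (toDual k H f ∘ₗ LinearMap.mulLeft k c) := by
  ext d
  exact evalLeft_comul f c d

theorem pair_ext {z z' : HopfDual k H ⊗[k] HopfDual k H}
    (h : ∀ c d, evalLeft c z d = evalLeft c z' d) : z = z' := by
  refine tensor_ext fun c => ?_
  ext d
  exact h c d

noncomputable instance : Coalgebra k (HopfDual k H) where
  coassoc := by
    ext1 f
    refine tensor_ext fun c => pair_ext fun d e => ?_
    have h : ∀ z : HopfDual k H ⊗[k] HopfDual k H, evalLeft d (evalLeft c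
        (TensorProduct.assoc k _ _ _ ((comul : HopfDual k H →ₗ[k] _).rTensor (HopfDual k H) z))) =
        evalLeft (c * d) z := by
      intro z
      induction z using TensorProduct.induction_on with
      | zero => simp
      | add x y hx hy => simp only [map_add, hx, hy]
      | tmul f g =>
        have h' : ∀ z : HopfDual k H ⊗[k] HopfDual k H, evalLeft d (evalLeft c
          (TensorProduct.assoc k _ _ _ (z ⊗ₜ g))) = evalLeft c z d • g := by
          intro z
          induction z using TensorProduct.induction_on with
          | zero => simp
          | add x y hx hy => simp only [map_add, TensorProduct.add_tmul, hx, hy, add_smul, add_apply]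
          | tmul p q => simp [smul_smul]
        rw [LinearMap.rTensor_tmul, h', evalLeft_comul, evalLeft_tmul]
    simp only [LinearMap.comp_apply, LinearEquiv.coe_coe, h, evalLeft_lTensor]
    rw [evalLeft_comul, evalLeft_comul, evalLeft_comul']
    simp [mul_assoc]
  rTensor_counit_comp_comul := by
    ext1 f
    apply (TensorProduct.lid k _).injective
    change evalLeft 1 (comul (R := k) f) = _
    rw [evalLeft_comul']
    ext d
    simp
  lTensor_counit_comp_comul := by
    ext1 f
    refine tensor_ext fun c => ?_
    simp only [LinearMap.comp_apply, evalLeft_lTensor]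
    rw [evalLeft_comul', counit_apply]
    simp

theorem mul_t {n : ℕ} (T : DoubleAux.Coeff k H n) (f g : HopfDual k H) (i j : Fin n) :
    (f * g) (T.t i j) = ∑ l, f (T.t i l) * g (T.t l j) := by
  rw [mul_apply, T.comul_t]
  simp

theorem t_ext {n : ℕ} (T : DoubleAux.Coeff k H n) {f g : HopfDual k H}
    (h : ∀ i j, f (T.t i j) = g (T.t i j)) : f = g :=
  (toDual k H).injective (T.ext h)

theorem pair_t_ext {n : ℕ} (T : DoubleAux.Coeff k H n) {z z' : HopfDual k H ⊗[k] HopfDual k H}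
    (h : ∀ i j p q, evalLeft (T.t i j) z (T.t p q) = evalLeft (T.t i j) z' (T.t p q)) : z = z' := by
  apply dualTensorEquiv.injective
  apply TensorProduct.ext
  refine T.ext fun i j => T.ext fun p q => ?_
  simpa [dualTensorEquiv_eval] using h i j p q

theorem evalLeft_mul {n : ℕ} (T : DoubleAux.Coeff k H n) (z w : HopfDual k H ⊗[k] HopfDual k H)
    (i j p q : Fin n) : evalLeft (T.t i j) (z * w) (T.t p q) =
      ∑ l, ∑ m, evalLeft (T.t i l) z (T.t p m) * evalLeft (T.t l j) w (T.t m q) := by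
  induction z using TensorProduct.induction_on with
  | zero => simp
  | add x y hx hy => simp [add_mul, hx, hy, Finset.sum_add_distrib]
  | tmul f f' =>
    induction w using TensorProduct.induction_on with
    | zero => simp
    | add x y hx hy => simp [mul_add, hx, hy, Finset.sum_add_distrib]
    | tmul g g' =>
      rw [Algebra.TensorProduct.tmul_mul_tmul]
      simp only [evalLeft_tmul, smul_apply, mul_t,
        Finset.sum_mul_sum]
      refine Finset.sum_congr rfl fun l _ => Finset.sum_congr rfl fun m _ => ?_
      ring

noncomputable instance : Bialgebra k (HopfDual k H) :=
  Bialgebra.mk' k (HopfDual k H)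
    (by rw [counit_apply]; simp)
    (by
      intro f g
      rw [counit_apply, mul_apply, Bialgebra.comul_one,
        Algebra.TensorProduct.one_def]
      simp [counit_apply])
    (by
      refine pair_ext fun c d => ?_
      rw [evalLeft_comul, Algebra.TensorProduct.one_def, evalLeft_tmul]
      simp)
    (by
      intro f g
      obtain ⟨n, ⟨T⟩⟩ := DoubleAux.exists_coeff (k := k) (C := H)
      refine pair_t_ext T fun i j p q => ?_
      rw [evalLeft_comul, evalLeft_mul T]
      rw [mul_apply, Bialgebra.comul_mul, T.comul_t, T.comul_t, Finset.sum_mul_sum]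
      simp [evalLeft_comul])

theorem antipode_aux {n : ℕ} (T : DoubleAux.Coeff k H n) (φ ψ : H →ₗ[k] H)
    (z : HopfDual k H ⊗[k] HopfDual k H) (i j : Fin n) :
    (LinearMap.mul' k (HopfDual k H) (TensorProduct.map
      ((toDual k H).symm.toLinearMap ∘ₗ φ.dualMap ∘ₗ
        (toDual k H).toLinearMap)
      ((toDual k H).symm.toLinearMap ∘ₗ ψ.dualMap ∘ₗ
        (toDual k H).toLinearMap) z)) (T.t i j) =
      ∑ l, evalLeft (φ (T.t i l)) z (ψ (T.t l j)) := by
  induction z using TensorProduct.induction_on with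
  | zero => simp
  | add x y hx hy => simp [hx, hy, Finset.sum_add_distrib]
  | tmul f g =>
    rw [TensorProduct.map_tmul, LinearMap.mul'_apply, mul_t]
    simp

/-- The antipode of the dual is the transpose of the antipode. -/
noncomputable instance : HopfAlgebra k (HopfDual k H) where
  antipode := (toDual k H).symm.toLinearMap ∘ₗ
    (antipode k (A := H)).dualMap ∘ₗ (toDual k H).toLinearMap
  mul_antipode_rTensor_comul := by
    obtain ⟨n, ⟨T⟩⟩ := DoubleAux.exists_coeff (k := k) (C := H)
    ext1 f
    refine t_ext T fun i j => ?_
    refine (antipode_aux T (antipode k) LinearMap.id (comul (R := k) f) i j).trans ?_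
    simp only [evalLeft_comul, ← map_sum, LinearMap.id_apply, T.S_mul]
    simp only [LinearMap.comp_apply, Algebra.linearMap_apply, counit_apply,
      algebraMap_apply, T.counit_t]
    split_ifs <;> simp
  mul_antipode_lTensor_comul := by
    obtain ⟨n, ⟨T⟩⟩ := DoubleAux.exists_coeff (k := k) (C := H)
    ext1 f
    refine t_ext T fun i j => ?_
    refine (antipode_aux T LinearMap.id (antipode k) (comul (R := k) f) i j).trans ?_
    simp only [evalLeft_comul, ← map_sum, LinearMap.id_apply, T.mul_S]
    simp only [LinearMap.comp_apply, Algebra.linearMap_apply, counit_apply,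
      algebraMap_apply, T.counit_t]
    split_ifs <;> simp

end HopfDual

/-! ### The Drinfeld double -/

open DoubleAux

section inverse
variable (k : Type*) (H : Type*) [Field k] [Ring H] [HopfAlgebra k H] [FiniteDimensional k H]

/-- The inverse `S⁻¹` of the antipode of a finite-dimensional Hopf algebra. -/
noncomputable def antipodeInv : H ≃ₗ[k] H :=
  (LinearEquiv.ofBijective (antipode k) antipode_bijective).symm

variable {k H}

@[simp] theorem antipode_antipodeInv (x : H) : antipode k (antipodeInv k H x) = x :=
  (LinearEquiv.ofBijective (antipode k) antipode_bijective).apply_symm_apply x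

theorem antipodeInv_mul (x y : H) :
    antipodeInv k H (x * y) = antipodeInv k H y * antipodeInv k H x := by
  apply (antipode_injective (k := k) (H := H))
  simp [antipode_mul_antidistrib]

theorem antipodeInv_one : antipodeInv k H 1 = 1 := by
  apply (antipode_injective (k := k) (H := H))
  simp

theorem counit_antipodeInv (x : H) : counit (R := k) (antipodeInv k H x) = counit (R := k) x := by
  rw [← counit_antipode, antipode_antipodeInv]

variable {n : ℕ} (T : Coeff k H n)

theorem Si_mul (i j : Fin n) : ∑ l, antipodeInv k H (T.t l j) * T.t i l = if i = j then 1 else 0 := by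
  apply (antipode_injective (k := k) (H := H))
  simp only [map_sum, antipode_mul_antidistrib, antipode_antipodeInv, T.S_mul]
  split_ifs <;> simp

theorem mul_Si (i j : Fin n) : ∑ l, T.t l j * antipodeInv k H (T.t i l) = if i = j then 1 else 0 := by
  apply (antipode_injective (k := k) (H := H))
  simp only [map_sum, antipode_mul_antidistrib, antipode_antipodeInv, T.mul_S]
  split_ifs <;> simp

theorem comul_Si (i j : Fin n) : comul (R := k) (antipodeInv k H (T.t i j)) =
    ∑ l, antipodeInv k H (T.t l j) ⊗ₜ[k] antipodeInv k H (T.t i l) := by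
  have e : (comul (R := k) : H →ₗ[k] _) ∘ₗ antipode k =
      TensorProduct.map (antipode k) (antipode k) ∘ₗ (TensorProduct.comm k H H).toLinearMap ∘ₗ
        comul := T.ext fun i j => by simp [T.comul_S, T.comul_t]
  have inj : Function.Injective (TensorProduct.map (antipode k (A := H)) (antipode k (A := H))) := by
    let e := LinearEquiv.ofBijective (antipode k (A := H)) antipode_bijective
    exact (TensorProduct.congr e e).injective
  apply inj
  apply (TensorProduct.comm k H H).injective
  have e' := LinearMap.congr_fun e (antipodeInv k H (T.t i j))
  simp only [LinearMap.comp_apply, antipode_antipodeInv, T.comul_t] at e'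
  have c : ∀ z : H ⊗[k] H, TensorProduct.map (antipode k) (antipode k) (TensorProduct.comm k H H z) =
      TensorProduct.comm k H H (TensorProduct.map (antipode k) (antipode k) z) := by
    intro z
    induction z using TensorProduct.induction_on with
    | zero => simp
    | tmul => simp
    | add x y hx hy => simp only [map_add, hx, hy]
  rw [LinearEquiv.coe_coe, c] at e'
  rw [← e']
  simp

end inverse

section double
variable (k : Type*) (H : Type*) [Field k] [Ring H] [HopfAlgebra k H] 

/-- The co-opposite coalgebra `C^cop`, with comultiplication `c ↦ ∑ c₂ ⊗ c₁`. -/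
@[reducible] noncomputable def coopCoalgebra (C : Type*) [AddCommGroup C] [Module k C]
    [Coalgebra k C] [FiniteDimensional k C] : Coalgebra k C where
  comul := (TensorProduct.comm k C C).toLinearMap ∘ₗ comul
  counit := counit
  coassoc := by
    obtain ⟨n, ⟨T⟩⟩ := exists_coeff (k := k) (C := C)
    refine T.ext fun i j => ?_
    simp only [LinearMap.comp_apply, LinearEquiv.coe_coe, T.comul_t, map_sum,
      TensorProduct.comm_tmul, LinearMap.rTensor_tmul, LinearMap.lTensor_tmul,
      TensorProduct.sum_tmul, TensorProduct.tmul_sum, TensorProduct.assoc_tmul]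
    rw [Finset.sum_comm]
  rTensor_counit_comp_comul := by
    obtain ⟨n, ⟨T⟩⟩ := exists_coeff (k := k) (C := C)
    refine T.ext fun i j => ?_
    simp [LinearMap.comp_apply, LinearEquiv.coe_coe, T.comul_t, T.counit_t, TensorProduct.ite_tmul]
  lTensor_counit_comp_comul := by
    obtain ⟨n, ⟨T⟩⟩ := exists_coeff (k := k) (C := C)
    refine T.ext fun i j => ?_
    simp [LinearMap.comp_apply, LinearEquiv.coe_coe, T.comul_t, T.counit_t, TensorProduct.tmul_ite]

/-- The functional `a ⇀ g ↼ b`, with `⟨a ⇀ g ↼ b, c⟩ = ⟨g, b c a⟩`. -/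
noncomputable def biHit : H →ₗ[k] H →ₗ[k] HopfDual k H →ₗ[k] HopfDual k H :=
  LinearMap.mk₂ k (fun a b => (HopfDual.toDual k H).symm.toLinearMap ∘ₗ
      (LinearMap.mulLeft k b ∘ₗ LinearMap.mulRight k a).dualMap ∘ₗ (HopfDual.toDual k H).toLinearMap)
    (fun a a' b => by ext; simp [mul_add])
    (fun r a b => by ext; simp)
    (fun a b b' => by ext; simp [add_mul])
    (fun r a b => by ext; simp)

variable {k H}

@[simp] theorem biHit_apply (a b : H) (g : HopfDual k H) (c : H) :
    biHit k H a b g c = g (b * (c * a)) := rfl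

variable [FiniteDimensional k H]

variable (k H)

/-- `h₁ ⊗ h₂ ⊗ h₃ ↦ (g ⊗ c ↦ (h₁ ⇀ g ↼ S⁻¹ h₃) ⊗ h₂ c)`. -/
noncomputable def tripleAct :
    H ⊗[k] (H ⊗[k] H) →ₗ[k] Module.End k (HopfDual k H ⊗[k] H) :=
  TensorProduct.homTensorHomMap (RingHom.id k) (HopfDual k H) H (HopfDual k H) H ∘ₗ
    TensorProduct.map
      (TensorProduct.lift ((biHit k H).compl₂ (antipodeInv k H).toLinearMap)) (LinearMap.mul k H) ∘ₗ
    (TensorProduct.assoc k H H H).symm.toLinearMap ∘ₗ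
    (TensorProduct.comm k H H).toLinearMap.lTensor H

/-- Left multiplication by `ε ⊗ h` in the Drinfeld double:
`g ⊗ c ↦ ∑ (h₁ ⇀ g ↼ S⁻¹ h₃) ⊗ h₂ c`. -/
noncomputable def leftAct : H →ₗ[k] Module.End k (HopfDual k H ⊗[k] H) :=
  tripleAct k H ∘ₗ (comul (R := k)).lTensor H ∘ₗ comul

variable {k H}

@[simp] theorem tripleAct_tmul (u v w : H) : tripleAct k H (u ⊗ₜ (v ⊗ₜ w)) =
    TensorProduct.map (biHit k H u (antipodeInv k H w)) (LinearMap.mulLeft k v) := rfl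

variable {n : ℕ} (T : Coeff k H n)

theorem leftAct_t (i j : Fin n) : leftAct k H (T.t i j) = ∑ a, ∑ b,
    TensorProduct.map (biHit k H (T.t i a) (antipodeInv k H (T.t b j)))
      (LinearMap.mulLeft k (T.t a b)) := by
  simp [leftAct, T.comul_t, TensorProduct.tmul_sum]

theorem leftAct_t_tmul (i j : Fin n) (g : HopfDual k H) (c : H) :
    leftAct k H (T.t i j) (g ⊗ₜ c) = ∑ a, ∑ b,
      biHit k H (T.t i a) (antipodeInv k H (T.t b j)) g ⊗ₜ[k] (T.t a b * c) := by
  simp [leftAct_t, LinearMap.sum_apply]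

theorem sum_comm4 {M : Type*} [AddCommMonoid M] (F : Fin n → Fin n → Fin n → Fin n → M) :
    ∑ a, ∑ b, ∑ c, ∑ d, F a b c d = ∑ c, ∑ d, ∑ a, ∑ b, F a b c d := by
  calc _ = ∑ a, ∑ c, ∑ b, ∑ d, F a b c d := Finset.sum_congr rfl fun _ _ => Finset.sum_comm
    _ = ∑ c, ∑ a, ∑ b, ∑ d, F a b c d := Finset.sum_comm
    _ = ∑ c, ∑ a, ∑ d, ∑ b, F a b c d :=
      Finset.sum_congr rfl fun _ _ => Finset.sum_congr rfl fun _ _ => Finset.sum_comm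
    _ = _ := Finset.sum_congr rfl fun _ _ => Finset.sum_comm

theorem leftAct_mul (h h' : H) : leftAct k H (h * h') = leftAct k H h * leftAct k H h' := by
  have key : ∀ x y : H ⊗[k] (H ⊗[k] H), tripleAct k H (x * y) = tripleAct k H x * tripleAct k H y := by
    suffices e : (LinearMap.mul k (H ⊗[k] (H ⊗[k] H))).compr₂ (tripleAct k H) =
        (LinearMap.mul k (Module.End k (HopfDual k H ⊗[k] H))).compl₁₂ (tripleAct k H)
          (tripleAct k H) from fun x y => LinearMap.congr_fun (LinearMap.congr_fun e x) y
    apply TensorProduct.ext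
    ext1 u
    apply TensorProduct.ext
    ext1 v
    ext1 w
    apply TensorProduct.ext
    ext1 u'
    apply TensorProduct.ext
    ext1 v'
    ext1 w'
    apply TensorProduct.ext'
    intro g c
    simp only [LinearMap.compr₂_apply, TensorProduct.mk_apply, LinearMap.mul_apply',
      LinearMap.compl₁₂_apply, Algebra.TensorProduct.tmul_mul_tmul, tripleAct_tmul,
      Module.End.mul_apply, TensorProduct.map_tmul, LinearMap.compr₂ₛₗ_apply]
    congr 1
    · ext d; simp [antipodeInv_mul, mul_assoc]
    · simp [mul_assoc]
  have e : ∀ x y : H ⊗[k] H, (comul (R := k)).lTensor H (x * y) =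
      (comul (R := k)).lTensor H x * (comul (R := k)).lTensor H y := by
    intro x y
    exact map_mul (Algebra.TensorProduct.map (AlgHom.id k H) (Bialgebra.comulAlgHom k H)) x y
  simp only [leftAct, LinearMap.comp_apply, Bialgebra.comul_mul, e, key]

theorem leftAct_one : leftAct k H 1 = 1 := by
  apply TensorProduct.ext'
  intro g c
  simp only [leftAct, LinearMap.comp_apply, Bialgebra.comul_one, Algebra.TensorProduct.one_def,
    LinearMap.lTensor_tmul, tripleAct_tmul, TensorProduct.map_tmul, antipodeInv_one]
  congr 1
  · ext d; simp
  · simp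

theorem biHit_mul (p q r s : Fin n) (g g' : HopfDual k H) :
    biHit k H (T.t p q) (antipodeInv k H (T.t r s)) (g * g') =
      ∑ x, ∑ y, biHit k H (T.t p x) (antipodeInv k H (T.t y s)) g *
        biHit k H (T.t x q) (antipodeInv k H (T.t r y)) g' := by
  refine HopfDual.t_ext T fun i j => ?_
  rw [biHit_apply, HopfDual.mul_apply]
  simp only [Bialgebra.comul_mul, T.comul_t, comul_Si, Finset.sum_mul_sum, Finset.sum_mul,
    Finset.mul_sum, Algebra.TensorProduct.tmul_mul_tmul, map_sum, HopfDual.sum_apply,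
    HopfDual.mul_t, biHit_apply]
  simp only [TensorProduct.map_tmul, LinearMap.mul'_apply, HopfDual.toDual_apply]
  exact Finset.sum_congr rfl fun _ _ => Finset.sum_comm

/-- `h · (g z) = ∑ (h₁ ⇀ g ↼ S⁻¹ h₃) (h₂ · z)`. -/
theorem leftAct_rTensor (i j : Fin n) (g : HopfDual k H) (z : HopfDual k H ⊗[k] H) :
    leftAct k H (T.t i j) ((LinearMap.mulLeft k g).rTensor H z) = ∑ a, ∑ b,
      (LinearMap.mulLeft k (biHit k H (T.t i a) (antipodeInv k H (T.t b j)) g)).rTensor H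
        (leftAct k H (T.t a b) z) := by
  induction z using TensorProduct.induction_on with
  | zero => simp
  | add x y hx hy => simp only [map_add, hx, hy, Finset.sum_add_distrib]
  | tmul g' c =>
    simp only [LinearMap.rTensor_tmul, leftAct_t_tmul, LinearMap.mulLeft_apply, biHit_mul T,
      map_sum, TensorProduct.sum_tmul]
    exact sum_comm4 _


variable (k H)

/-- The multiplication of the Drinfeld double:
`(f ⊗ h)(g ⊗ c) = ∑ f (h₁ ⇀ g ↼ S⁻¹ h₃) ⊗ h₂ c`. -/
noncomputable def mulMap : HopfDual k H ⊗[k] H →ₗ[k] Module.End k (HopfDual k H ⊗[k] H) :=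
  TensorProduct.lift ((LinearMap.mul k (Module.End k (HopfDual k H ⊗[k] H))).compl₁₂
    (LinearMap.rTensorHom H ∘ₗ LinearMap.mul k (HopfDual k H)) (leftAct k H))

variable {k H}

theorem mulMap_tmul (f : HopfDual k H) (h : H) (z : HopfDual k H ⊗[k] H) : mulMap k H (f ⊗ₜ h) z =
    (LinearMap.mulLeft k f).rTensor H (leftAct k H h z) := rfl

theorem rTensor_mulLeft_mul (f g : HopfDual k H) (z : HopfDual k H ⊗[k] H) :
    (LinearMap.mulLeft k (f * g)).rTensor H z =
      (LinearMap.mulLeft k f).rTensor H ((LinearMap.mulLeft k g).rTensor H z) := by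
  rw [LinearMap.mulLeft_mul, LinearMap.rTensor_comp, LinearMap.comp_apply]

theorem mulMap_mulMap (x y z : HopfDual k H ⊗[k] H) :
    mulMap k H (mulMap k H x y) z = mulMap k H x (mulMap k H y z) := by
  obtain ⟨n, ⟨T⟩⟩ := exists_coeff (k := k) (C := H)
  induction y using TensorProduct.induction_on with
  | zero => simp
  | add y y' hy hy' => simp only [map_add, LinearMap.add_apply, hy, hy']
  | tmul g h' =>
    induction x using TensorProduct.induction_on with
    | zero => simp
    | add x x' hx hx' => simp only [map_add, LinearMap.add_apply, hx, hx']
    | tmul f h =>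
      have e : ∀ i j, mulMap k H (mulMap k H (f ⊗ₜ T.t i j) (g ⊗ₜ h')) z =
          mulMap k H (f ⊗ₜ T.t i j) (mulMap k H (g ⊗ₜ h') z) := by
        intro i j
        rw [mulMap_tmul g, mulMap_tmul f _ ((LinearMap.rTensor _ _) _), leftAct_rTensor T]
        rw [mulMap_tmul, leftAct_t_tmul]
        simp only [map_sum, LinearMap.sum_apply, LinearMap.rTensor_tmul, mulMap_tmul, leftAct_mul,
          LinearMap.mulLeft_apply, rTensor_mulLeft_mul, Module.End.mul_apply]
      let F : H →ₗ[k] HopfDual k H ⊗[k] H :=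
        LinearMap.applyₗ z ∘ₗ mulMap k H ∘ₗ LinearMap.applyₗ (g ⊗ₜ h') ∘ₗ mulMap k H ∘ₗ
          TensorProduct.mk k _ _ f
      let G : H →ₗ[k] HopfDual k H ⊗[k] H :=
        LinearMap.applyₗ (mulMap k H (g ⊗ₜ h') z) ∘ₗ mulMap k H ∘ₗ TensorProduct.mk k _ _ f
      have : F = G := T.ext e
      exact LinearMap.congr_fun this h

theorem mulMap_one (x : HopfDual k H ⊗[k] H) : mulMap k H (1 ⊗ₜ 1) x = x := by
  rw [mulMap_tmul, leftAct_one]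
  simp

theorem leftAct_one_tmul (h c : H) : leftAct k H h ((1 : HopfDual k H) ⊗ₜ c) = 1 ⊗ₜ (h * c) := by
  obtain ⟨n, ⟨T⟩⟩ := exists_coeff (k := k) (C := H)
  let F : H →ₗ[k] HopfDual k H ⊗[k] H := LinearMap.applyₗ ((1 : HopfDual k H) ⊗ₜ c) ∘ₗ leftAct k H
  let G : H →ₗ[k] HopfDual k H ⊗[k] H := TensorProduct.mk k _ _ 1 ∘ₗ LinearMap.mulRight k c
  suffices F = G from LinearMap.congr_fun this h
  refine T.ext fun i j => ?_
  change leftAct k H (T.t i j) ((1 : HopfDual k H) ⊗ₜ c) = 1 ⊗ₜ (T.t i j * c)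
  rw [leftAct_t_tmul]
  have e : ∀ a b, biHit k H (T.t i a) (antipodeInv k H (T.t b j)) 1 =
      (if i = a then (1 : k) else 0) • (if b = j then (1 : k) else 0) • (1 : HopfDual k H) := by
    intro a b
    ext d
    rw [biHit_apply, HopfDual.one_apply, Bialgebra.counit_mul, Bialgebra.counit_mul, counit_antipodeInv,
      T.counit_t, T.counit_t, HopfDual.smul_apply, HopfDual.smul_apply, HopfDual.one_apply]
    ring
  simp only [e]
  rw [Finset.sum_eq_single i]
  · rw [Finset.sum_eq_single j]
    · simp
    · intro b _ hb; simp [hb]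
    · simp
  · intro b _ hb; simp [hb.symm]
  · simp

theorem mulMap_apply_one (x : HopfDual k H ⊗[k] H) : mulMap k H x (1 ⊗ₜ 1) = x := by
  induction x using TensorProduct.induction_on with
  | zero => simp
  | add x y hx hy => simp only [map_add, LinearMap.add_apply, hx, hy]
  | tmul f h => rw [mulMap_tmul, leftAct_one_tmul]; simp

end double

/-- The Drinfeld double `D(H)`, whose underlying space is `H^* ⊗ H`. Its multiplication is
`(f ⊗ h)(g ⊗ c) = ∑ f (h₁ ⇀ g ↼ S⁻¹ h₃) ⊗ h₂ c` and as a coalgebra it is `(H^*)^cop ⊗ H`. -/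
def DrinfeldDouble (k : Type*) (H : Type*) [Field k] [Ring H] [HopfAlgebra k H] : Type _ :=
  HopfDual k H ⊗[k] H

namespace DrinfeldDouble
variable {k : Type*} {H : Type*} [Field k] [Ring H] [HopfAlgebra k H]

/-- The additive group of the tensor product. -/
@[reducible] noncomputable def addCommGroupAux : AddCommGroup (DrinfeldDouble k H) :=
  inferInstanceAs (AddCommGroup (HopfDual k H ⊗[k] H))

/-- The element `f ⊗ h` of `D(H)`, also written `f h`. -/
noncomputable def tmul (f : HopfDual k H) (h : H) : DrinfeldDouble k H := f ⊗ₜ[k] h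

variable [FiniteDimensional k H]

noncomputable instance : Ring (DrinfeldDouble k H) :=
  { addCommGroupAux with
    mul := fun x y => mulMap k H x y
    one := tmul 1 1
    mul_assoc := mulMap_mulMap
    one_mul := mulMap_one
    mul_one := mulMap_apply_one
    zero_mul := fun x => LinearMap.congr_fun (map_zero (mulMap k H)) x
    mul_zero := fun x => map_zero (mulMap k H x)
    left_distrib := fun x => map_add (mulMap k H x)
    right_distrib := fun x y z => LinearMap.congr_fun ((mulMap k H).map_add x y) z }

theorem mul_def (x y : DrinfeldDouble k H) : x * y = mulMap k H x y := rfl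

noncomputable instance : Algebra k (DrinfeldDouble k H) :=
  letI : Module k (DrinfeldDouble k H) := inferInstanceAs (Module k (HopfDual k H ⊗[k] H))
  Algebra.ofModule (fun r x y => LinearMap.congr_fun (map_smul (mulMap k H) r x) y)
    (fun r x y => map_smul (mulMap k H x) r y)

/-- The tensor product coalgebra `(H^*)^cop ⊗ H`. -/
noncomputable instance : Coalgebra k (DrinfeldDouble k H) :=
  @TensorProduct.instCoalgebra k k (HopfDual k H) H _ _ _ _ _ _ _ _ _ _
    (coopCoalgebra k (HopfDual k H))

theorem tmul_induction {P : DrinfeldDouble k H → Prop} (h0 : P 0)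
    (ht : ∀ f h, P (tmul f h)) (ha : ∀ x y, P x → P y → P (x + y)) (x : DrinfeldDouble k H) : P x :=
  TensorProduct.induction_on x h0 ht ha

variable (k H) in
/-- `f ⊗ h` as a bilinear map. -/
noncomputable def mk : HopfDual k H →ₗ[k] H →ₗ[k] DrinfeldDouble k H :=
  LinearMap.mk₂ k tmul TensorProduct.add_tmul (fun c m n => (TensorProduct.smul_tmul' c m n).symm)
    TensorProduct.tmul_add (fun c m n => TensorProduct.tmul_smul c m n)

@[simp] theorem mk_apply (f : HopfDual k H) (h : H) : mk k H f h = tmul f h := rfl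

theorem lin_ext {M : Type*} [AddCommMonoid M] [Module k M] {F G : DrinfeldDouble k H →ₗ[k] M}
    (h : ∀ f h, F (tmul f h) = G (tmul f h)) : F = G := by
  ext1 x
  induction x using tmul_induction with
  | h0 => rw [map_zero, map_zero]
  | ht f c => exact h f c
  | ha x y hx hy => rw [map_add, map_add, hx, hy]

theorem one_def : (1 : DrinfeldDouble k H) = tmul 1 1 := rfl

theorem mul_t_tmul {n : ℕ} (T : Coeff k H n) (f g : HopfDual k H) (i j : Fin n) (c : H) :
    tmul f (T.t i j) * tmul g c = ∑ a, ∑ b,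
      tmul (f * biHit k H (T.t i a) (antipodeInv k H (T.t b j)) g) (T.t a b * c) := by
  have e : mulMap k H (f ⊗ₜ T.t i j) (g ⊗ₜ c) = ∑ a, ∑ b,
      (f * biHit k H (T.t i a) (antipodeInv k H (T.t b j)) g) ⊗ₜ (T.t a b * c) := by
    rw [mulMap_tmul, leftAct_t_tmul]
    simp
  exact e

theorem tmul_one_mul (f g : HopfDual k H) (c : H) : tmul f 1 * tmul g c = tmul (f * g) c := by
  have e : mulMap k H (f ⊗ₜ 1) (g ⊗ₜ c) = (f * g) ⊗ₜ c := by
    rw [mulMap_tmul, leftAct_one]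
    simp
  exact e

theorem mul_one_tmul (f : HopfDual k H) (h c : H) : tmul f h * tmul 1 c = tmul f (h * c) := by
  have e : mulMap k H (f ⊗ₜ h) (1 ⊗ₜ c) = f ⊗ₜ (h * c) := by
    rw [mulMap_tmul, leftAct_one_tmul]
    simp
  exact e

theorem tmul_eq (f : HopfDual k H) (h : H) : tmul f h = tmul f 1 * tmul 1 h := by
  rw [tmul_one_mul, mul_one]

variable (k H) in
/-- `(p ⊗ q) ⊗ (u ⊗ v) ↦ (q ⊗ u) ⊗ (p ⊗ v)` -/
noncomputable def shuffle : (HopfDual k H ⊗[k] HopfDual k H) →ₗ[k] (H ⊗[k] H) →ₗ[k]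
    DrinfeldDouble k H ⊗[k] DrinfeldDouble k H :=
  LinearMap.flip (TensorProduct.lift (LinearMap.mk₂ k (fun u v => 
    TensorProduct.map ((mk k H).flip u) ((mk k H).flip v) ∘ₗ (TensorProduct.comm k _ _).toLinearMap)
    (fun u u' v => by
      rw [map_add, TensorProduct.map_add_left, LinearMap.add_comp])
    (fun c u v => by
      rw [map_smul, TensorProduct.map_smul_left, LinearMap.smul_comp])
    (fun u v v' => by
      rw [map_add, TensorProduct.map_add_right, LinearMap.add_comp])
    (fun c u v => by
      rw [map_smul, TensorProduct.map_smul_right, LinearMap.smul_comp])))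

@[simp] theorem shuffle_tmul (p q : HopfDual k H) (u v : H) :
    shuffle k H (p ⊗ₜ q) (u ⊗ₜ v) = tmul q u ⊗ₜ tmul p v := rfl

theorem comul_tmul (f : HopfDual k H) (h : H) :
    comul (R := k) (tmul f h) = shuffle k H (comul f) (comul h) := by
  have e : ∀ (z : HopfDual k H ⊗[k] HopfDual k H) (w : H ⊗[k] H),
      TensorProduct.AlgebraTensorModule.tensorTensorTensorComm k k k k (HopfDual k H) (HopfDual k H)
        H H (TensorProduct.comm k _ _ z ⊗ₜ w) = shuffle k H z w := by
    intro z w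
    induction z using TensorProduct.induction_on with
    | zero => simp; rfl
    | add x y hx hy => simp only [map_add, TensorProduct.add_tmul, LinearMap.add_apply, hx, hy]; rfl
    | tmul p q =>
      induction w using TensorProduct.induction_on with
      | zero => simp; rfl
      | add x y hx hy => simp only [map_add, TensorProduct.tmul_add, hx, hy]; rfl
      | tmul u v => rfl
  exact e _ _

theorem counit_tmul (f : HopfDual k H) (h : H) :
    counit (R := k) (tmul f h) = counit (R := k) h * f 1 := rfl

theorem biHit_comul {n : ℕ} (T : Coeff k H n) (g : HopfDual k H) (i a b d e j : Fin n) :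
    ∑ c, TensorProduct.map (biHit k H (T.t c d) (antipodeInv k H (T.t e j)))
      (biHit k H (T.t i a) (antipodeInv k H (T.t b c))) (comul (R := k) g) =
    if b = d then comul (R := k) (biHit k H (T.t i a) (antipodeInv k H (T.t e j)) g) else 0 := by
  refine HopfDual.pair_ext fun x y => ?_
  have h : ∀ (u v u' v' : H) (z : HopfDual k H ⊗[k] HopfDual k H),
      HopfDual.evalLeft x (TensorProduct.map (biHit k H u v) (biHit k H u' v') z) y =
        HopfDual.evalLeft (v * (x * u)) z (v' * (y * u')) := by
    intro u v u' v' z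
    induction z using TensorProduct.induction_on with
    | zero => simp
    | add x y hx hy => simp only [map_add, HopfDual.add_apply, hx, hy]
    | tmul p q => simp
  rw [map_sum, HopfDual.sum_apply]
  simp only [h, HopfDual.evalLeft_comul]
  have e1 : ∀ c, antipodeInv k H (T.t e j) * (x * T.t c d) * (antipodeInv k H (T.t b c) * (y * T.t i a)) =
    antipodeInv k H (T.t e j) * x * (T.t c d * antipodeInv k H (T.t b c)) * (y * T.t i a) := by
    intro c; simp only [mul_assoc]
  rw [← map_sum]
  simp only [e1, ← Finset.sum_mul, ← Finset.mul_sum, mul_Si]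
  split_ifs with hbd
  · rw [HopfDual.evalLeft_comul, biHit_apply]
    simp [mul_assoc]
  · simp

theorem shuffle_mul_shuffle {n : ℕ} (T : Coeff k H n) (f₁ f₂ : HopfDual k H) (c₁ c₂ : H)
    (i j : Fin n) (z : HopfDual k H ⊗[k] HopfDual k H) :
    shuffle k H (f₁ ⊗ₜ f₂) (comul (T.t i j)) * shuffle k H z (c₁ ⊗ₜ c₂) =
      ∑ a, ∑ b, ∑ d, ∑ e, shuffle k H ((f₁ ⊗ₜ f₂) * ∑ c,
        TensorProduct.map (biHit k H (T.t c d) (antipodeInv k H (T.t e j)))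
          (biHit k H (T.t i a) (antipodeInv k H (T.t b c))) z)
        ((T.t a b ⊗ₜ T.t d e) * (c₁ ⊗ₜ c₂)) := by
  induction z using TensorProduct.induction_on with
  | zero => simp
  | add x y hx hy =>
    simp only [map_add, mul_add, hx, hy, LinearMap.add_apply, Finset.sum_add_distrib]
  | tmul p q =>
    rw [T.comul_t]
    simp only [map_sum, shuffle_tmul, Finset.sum_mul, Algebra.TensorProduct.tmul_mul_tmul,
      mul_t_tmul T, TensorProduct.sum_tmul, TensorProduct.tmul_sum, TensorProduct.map_tmul,
      Finset.mul_sum, LinearMap.sum_apply]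
    calc _ = ∑ c, ∑ a, ∑ b, ∑ d, ∑ e, 
          (tmul (f₂ * biHit k H (T.t i a) (antipodeInv k H (T.t b c)) q) (T.t a b * c₁)) ⊗ₜ[k]
          (tmul (f₁ * biHit k H (T.t c d) (antipodeInv k H (T.t e j)) p) (T.t d e * c₂)) := by
          refine Finset.sum_congr rfl fun c _ => ?_
          exact sum_comm4 _
      _ = _ := by
          rw [Finset.sum_comm]
          refine Finset.sum_congr rfl fun a _ => ?_
          rw [Finset.sum_comm]
          refine Finset.sum_congr rfl fun b _ => ?_
          rw [Finset.sum_comm]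
          refine Finset.sum_congr rfl fun d _ => ?_
          rw [Finset.sum_comm]

theorem comul_mul (x y : DrinfeldDouble k H) :
    comul (R := k) (x * y) = comul (R := k) x * comul (R := k) y := by
  obtain ⟨n, ⟨T⟩⟩ := exists_coeff (k := k) (C := H)
  have main : ∀ (g : HopfDual k H) (i j : Fin n) (z : HopfDual k H ⊗[k] HopfDual k H)
      (w : H ⊗[k] H), ∑ a, ∑ b, shuffle k H
        (z * comul (biHit k H (T.t i a) (antipodeInv k H (T.t b j)) g)) (comul (T.t a b) * w) =
      shuffle k H z (comul (T.t i j)) * shuffle k H (comul g) w := by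
    intro g i j z w
    induction z using TensorProduct.induction_on with
    | zero => simp
    | add x y hx hy =>
      simp only [map_add, add_mul, LinearMap.add_apply, Finset.sum_add_distrib, hx, hy]
    | tmul f₁ f₂ =>
      induction w using TensorProduct.induction_on with
      | zero => simp
      | add x y hx hy =>
        simp only [map_add, mul_add, LinearMap.add_apply, Finset.sum_add_distrib, hx, hy]
      | tmul c₁ c₂ =>
        rw [shuffle_mul_shuffle T]
        simp only [biHit_comul]
        refine Finset.sum_congr rfl fun a _ => ?_
        calc _ = ∑ e, ∑ b, shuffle k H ((f₁ ⊗ₜ f₂) *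
              comul (biHit k H (T.t i a) (antipodeInv k H (T.t e j)) g))
                ((T.t a b ⊗ₜ T.t b e) * (c₁ ⊗ₜ c₂)) := by
              refine Finset.sum_congr rfl fun e _ => ?_
              rw [T.comul_t, Finset.sum_mul, map_sum]
          _ = _ := by
              rw [Finset.sum_comm]
              refine Finset.sum_congr rfl fun b _ => ?_
              symm
              rw [Finset.sum_eq_single b]
              · simp
              · intro d _ hd; simp [hd.symm]
              · simp
  have e : ∀ (f : HopfDual k H) (i j : Fin n) (g : HopfDual k H) (c : H), comul (R := k) (tmul f (T.t i j) * tmul g c) =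
      comul (R := k) (tmul f (T.t i j)) * comul (R := k) (tmul g c) := by
    intro f i j g c
    rw [mul_t_tmul]
    simp only [map_sum, comul_tmul, Bialgebra.comul_mul, main]
  induction x using tmul_induction with
  | h0 => simp
  | ha x y hx hy => simp only [map_add, add_mul, hx, hy]
  | ht f h =>
    induction y using tmul_induction with
    | h0 => simp
    | ha x y hx hy => simp only [map_add, mul_add, hx, hy]
    | ht g c =>
      have : comul ∘ₗ LinearMap.mulRight k (tmul g c) ∘ₗ mk k H f =
        LinearMap.mulRight k (comul (R := k) (tmul g c)) ∘ₗ comul ∘ₗ mk k H f :=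
          T.ext fun i j => e f i j g c
      exact LinearMap.congr_fun this h

theorem counit_mul (x y : DrinfeldDouble k H) :
    counit (R := k) (x * y) = counit (R := k) x * counit (R := k) y := by
  obtain ⟨n, ⟨T⟩⟩ := exists_coeff (k := k) (C := H)
  have e : ∀ (f : HopfDual k H) (i j : Fin n) (g : HopfDual k H) (c : H), counit (R := k) (tmul f (T.t i j) * tmul g c) =
      counit (R := k) (tmul f (T.t i j)) * counit (R := k) (tmul g c) := by
    intro f i j g c
    have h1 : ∀ p q : HopfDual k H, (p * q) 1 = p 1 * q 1 := fun p q =>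
      Bialgebra.counit_mul (R := k) p q
    rw [mul_t_tmul]
    simp only [map_sum, counit_tmul, Bialgebra.counit_mul, T.counit_t, h1, biHit_apply]
    calc _ = ∑ a, (f 1 * g (antipodeInv k H (T.t a j) * T.t i a)) * counit (R := k) c := by
          refine Finset.sum_congr rfl fun a _ => ?_
          rw [Finset.sum_eq_single a]
          · simp [mul_comm]
          · intro b _ hb; simp [hb.symm]
          · simp
      _ = _ := by
          rw [← Finset.sum_mul, ← Finset.mul_sum, ← map_sum, Si_mul]
          split_ifs <;> simp; ring
  induction x using tmul_induction with
  | h0 => simp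
  | ha x y hx hy => simp only [map_add, add_mul, hx, hy]
  | ht f h =>
    induction y using tmul_induction with
    | h0 => simp
    | ha x y hx hy => simp only [map_add, mul_add, hx, hy]
    | ht g c =>
      have : counit ∘ₗ LinearMap.mulRight k (tmul g c) ∘ₗ mk k H f =
        LinearMap.mulRight k (counit (R := k) (tmul g c)) ∘ₗ counit ∘ₗ mk k H f :=
          T.ext fun i j => e f i j g c
      exact LinearMap.congr_fun this h

noncomputable instance : Bialgebra k (DrinfeldDouble k H) :=
  Bialgebra.mk' k (DrinfeldDouble k H)
    (by rw [one_def, counit_tmul]; simp)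
    (counit_mul _ _)
    (by
      rw [one_def, comul_tmul, Bialgebra.comul_one, Bialgebra.comul_one]
      rfl)
    (comul_mul _ _)

variable (k H) in
/-- `f ↦ f ∘ S⁻¹` -/
noncomputable def transposeInv : HopfDual k H →ₗ[k] HopfDual k H :=
  (HopfDual.toDual k H).symm.toLinearMap ∘ₗ (antipodeInv k H).toLinearMap.dualMap ∘ₗ
    (HopfDual.toDual k H).toLinearMap

@[simp] theorem transposeInv_apply (f : HopfDual k H) (c : H) :
    transposeInv k H f c = f (antipodeInv k H c) := rfl

variable (k H) in
/-- The antipode `f ⊗ h ↦ (ε ⊗ S h) (f ∘ S⁻¹ ⊗ 1)`. -/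
noncomputable def antipodeMap : DrinfeldDouble k H →ₗ[k] DrinfeldDouble k H :=
  TensorProduct.lift ((LinearMap.mul k (DrinfeldDouble k H)).flip.compl₁₂
    ((mk k H).flip 1 ∘ₗ transposeInv k H) (mk k H 1 ∘ₗ antipode k))

theorem antipodeMap_tmul (f : HopfDual k H) (h : H) : antipodeMap k H (tmul f h) =
    tmul 1 (antipode k h) * tmul (transposeInv k H f) 1 := rfl

theorem zero_tmul (h : H) : tmul (0 : HopfDual k H) h = 0 :=
  LinearMap.congr_fun (map_zero (mk k H)) h

theorem add_tmul (f g : HopfDual k H) (h : H) : tmul (f + g) h = tmul f h + tmul g h :=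
  LinearMap.congr_fun ((mk k H).map_add f g) h

theorem antipode_left_aux (z : HopfDual k H ⊗[k] HopfDual k H) (u v : H) :
    LinearMap.mul' k _ ((antipodeMap k H).rTensor _ (shuffle k H z (u ⊗ₜ v))) =
      tmul 1 (antipode k u) * (tmul (LinearMap.mul' k _ ((transposeInv k H).rTensor _
        (TensorProduct.comm k _ _ z))) 1 * tmul 1 v) := by
  induction z using TensorProduct.induction_on with
  | zero =>
    simp only [map_zero, LinearMap.zero_apply, zero_tmul, zero_mul, mul_zero]
  | add x y hx hy =>
    simp only [map_add, LinearMap.add_apply, hx, hy, add_tmul, add_mul, mul_add]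
  | tmul p q =>
    simp only [shuffle_tmul, LinearMap.rTensor_tmul, LinearMap.mul'_apply, antipodeMap_tmul,
      TensorProduct.comm_tmul]
    rw [tmul_eq p v, ← tmul_one_mul, mul_assoc, mul_assoc]

theorem antipode_right_aux (z : HopfDual k H ⊗[k] HopfDual k H) (u v : H) :
    LinearMap.mul' k _ ((antipodeMap k H).lTensor _ (shuffle k H z (u ⊗ₜ v))) =
      TensorProduct.lift ((LinearMap.mul k (DrinfeldDouble k H)).compl₁₂ ((mk k H).flip (u * antipode k v))
        ((mk k H).flip 1 ∘ₗ transposeInv k H)) (TensorProduct.comm k _ _ z) := by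
  induction z using TensorProduct.induction_on with
  | zero => simp
  | add x y hx hy => simp only [map_add, LinearMap.add_apply, hx, hy]
  | tmul p q =>
    simp only [shuffle_tmul, LinearMap.lTensor_tmul, LinearMap.mul'_apply, antipodeMap_tmul,
      TensorProduct.comm_tmul]
    rw [← mul_assoc, mul_one_tmul]
    rfl

theorem transposeInv_left (f : HopfDual k H) : LinearMap.mul' k _ ((transposeInv k H).rTensor _
    (TensorProduct.comm k _ _ (comul (R := k) f))) = f 1 • (1 : HopfDual k H) := by
  obtain ⟨n, ⟨T⟩⟩ := exists_coeff (k := k) (C := H)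
  refine HopfDual.t_ext T fun i j => ?_
  have h : ∀ z : HopfDual k H ⊗[k] HopfDual k H, LinearMap.mul' k _ ((transposeInv k H).rTensor _
      (TensorProduct.comm k _ _ z)) (T.t i j) =
        ∑ l, HopfDual.evalLeft (T.t l j) z (antipodeInv k H (T.t i l)) := by
    intro z
    induction z using TensorProduct.induction_on with
    | zero => simp
    | add x y hx hy => simp only [map_add, HopfDual.add_apply, hx, hy, Finset.sum_add_distrib]
    | tmul p q => simp [HopfDual.mul_t, mul_comm]
  rw [h]
  simp only [HopfDual.evalLeft_comul, ← map_sum, mul_Si]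
  rw [HopfDual.smul_apply, HopfDual.one_apply, T.counit_t]
  split_ifs <;> simp

theorem transposeInv_right (f : HopfDual k H) : LinearMap.mul' k _ ((transposeInv k H).lTensor _
    (TensorProduct.comm k _ _ (comul (R := k) f))) = f 1 • (1 : HopfDual k H) := by
  obtain ⟨n, ⟨T⟩⟩ := exists_coeff (k := k) (C := H)
  refine HopfDual.t_ext T fun i j => ?_
  have h : ∀ z : HopfDual k H ⊗[k] HopfDual k H, LinearMap.mul' k _ ((transposeInv k H).lTensor _
      (TensorProduct.comm k _ _ z)) (T.t i j) =
        ∑ l, HopfDual.evalLeft (antipodeInv k H (T.t l j)) z (T.t i l) := by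
    intro z
    induction z using TensorProduct.induction_on with
    | zero => simp
    | add x y hx hy => simp only [map_add, HopfDual.add_apply, hx, hy, Finset.sum_add_distrib]
    | tmul p q => simp [HopfDual.mul_t, mul_comm]
  rw [h]
  simp only [HopfDual.evalLeft_comul, ← map_sum, Si_mul]
  rw [HopfDual.smul_apply, HopfDual.one_apply, T.counit_t]
  split_ifs <;> simp

theorem smul_tmul (r : k) (f : HopfDual k H) (h : H) : tmul (r • f) h = r • tmul f h := by
  rw [← mk_apply, ← mk_apply, map_smul]; rfl

noncomputable instance : HopfAlgebra k (DrinfeldDouble k H) where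
  antipode := antipodeMap k H
  mul_antipode_rTensor_comul := by
    obtain ⟨n, ⟨T⟩⟩ := exists_coeff (k := k) (C := H)
    refine lin_ext fun f h => ?_
    suffices e : (LinearMap.mul' k _ ∘ₗ (antipodeMap k H).rTensor _ ∘ₗ comul) ∘ₗ mk k H f =
        (Algebra.linearMap k _ ∘ₗ counit) ∘ₗ mk k H f from LinearMap.congr_fun e h
    refine T.ext fun i j => ?_
    simp only [LinearMap.comp_apply, mk_apply, comul_tmul, T.comul_t, map_sum, antipode_left_aux,
      transposeInv_left, counit_tmul, T.counit_t, smul_tmul, ← one_def, smul_one_mul,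
      mul_smul_comm, mul_one_tmul, ← Finset.smul_sum]
    simp only [← mk_apply, ← map_sum, T.S_mul]
    simp only [mk_apply, Algebra.linearMap_apply, Algebra.algebraMap_eq_smul_one]
    split_ifs
    · rw [← one_def]; simp
    · rw [← mk_apply, map_zero]; simp
  mul_antipode_lTensor_comul := by
    obtain ⟨n, ⟨T⟩⟩ := exists_coeff (k := k) (C := H)
    refine lin_ext fun f h => ?_
    suffices e : (LinearMap.mul' k _ ∘ₗ (antipodeMap k H).lTensor _ ∘ₗ comul) ∘ₗ mk k H f =
        (Algebra.linearMap k _ ∘ₗ counit) ∘ₗ mk k H f from LinearMap.congr_fun e h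
    refine T.ext fun i j => ?_
    simp only [LinearMap.comp_apply, mk_apply, comul_tmul, T.comul_t, map_sum, antipode_right_aux,
      counit_tmul, T.counit_t]
    have h1 : ∀ (w : H) (z : HopfDual k H ⊗[k] HopfDual k H), TensorProduct.lift
        ((LinearMap.mul k (DrinfeldDouble k H)).compl₁₂ ((mk k H).flip w)
        ((mk k H).flip 1 ∘ₗ transposeInv k H)) z = TensorProduct.lift
        ((LinearMap.mul k (DrinfeldDouble k H)).compl₁₂ ((mk k H).flip w)
        ((mk k H).flip 1)) ((transposeInv k H).lTensor _ z) := by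
      intro w z
      induction z using TensorProduct.induction_on with
      | zero => simp
      | add x y hx hy => simp only [map_add, hx, hy]
      | tmul p q => simp
    have h2 : ∀ (z : HopfDual k H ⊗[k] HopfDual k H), TensorProduct.lift
        ((LinearMap.mul k (DrinfeldDouble k H)).compl₁₂ ((mk k H).flip 1)
        ((mk k H).flip 1)) z = tmul (LinearMap.mul' k _ z) 1 := by
      intro z
      rw [← mk_apply]
      induction z using TensorProduct.induction_on with
      | zero => simp
      | add x y hx hy => simp only [map_add, hx, hy, LinearMap.add_apply]
      | tmul p q => simp [tmul_one_mul]
    have h3 : ∀ (s : Fin n → H) (z : HopfDual k H ⊗[k] HopfDual k H), ∑ l, TensorProduct.lift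
        ((LinearMap.mul k (DrinfeldDouble k H)).compl₁₂ ((mk k H).flip (s l))
        ((mk k H).flip 1)) z = TensorProduct.lift
        ((LinearMap.mul k (DrinfeldDouble k H)).compl₁₂ ((mk k H).flip (∑ l, s l))
        ((mk k H).flip 1)) z := by
      intro s z
      induction z using TensorProduct.induction_on with
      | zero => simp
      | add x y hx hy => simp only [map_add, Finset.sum_add_distrib, hx, hy]
      | tmul p q =>
        simp only [TensorProduct.lift.tmul, LinearMap.compl₁₂_apply, LinearMap.flip_apply, map_sum,
          LinearMap.sum_apply]
    simp only [h1, h3, T.mul_S]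
    split_ifs
    · rw [h2, transposeInv_right, smul_tmul, ← one_def]
      simp [Algebra.algebraMap_eq_smul_one]
    · have : ∀ z : HopfDual k H ⊗[k] HopfDual k H, TensorProduct.lift
          ((LinearMap.mul k (DrinfeldDouble k H)).compl₁₂ ((mk k H).flip 0)
          ((mk k H).flip 1)) z = 0 := by
        intro z
        induction z using TensorProduct.induction_on with
        | zero => simp
        | add x y hx hy => simp only [map_add, hx, hy, add_zero]
        | tmul p q =>
          rw [TensorProduct.lift.tmul, LinearMap.compl₁₂_apply, map_zero]
          simp
      rw [this]; simp

variable (k H) in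
/-- The standard universal R-matrix `∑ i, (ε ⊗ e i) ⊗ (eⁱ ⊗ 1)` of `D(H)`, where `e` is a basis of
`H` and `eⁱ` is the dual basis; see `universalR_eq` for the independence of the basis. -/
noncomputable def universalR : DrinfeldDouble k H ⊗[k] DrinfeldDouble k H :=
  ∑ i, tmul 1 (Module.finBasis k H i) ⊗ₜ[k]
    tmul ((HopfDual.toDual k H).symm ((Module.finBasis k H).coord i)) 1

theorem universalR_eq {ι : Type*} [Fintype ι] (b : Module.Basis ι k H) : universalR k H =
    ∑ i, tmul 1 (b i) ⊗ₜ[k] tmul ((HopfDual.toDual k H).symm (b.coord i)) 1 := by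
  let c := Module.finBasis k H
  let φ : Module.Dual k H →ₗ[k] DrinfeldDouble k H :=
    (mk k H).flip 1 ∘ₗ (HopfDual.toDual k H).symm.toLinearMap
  have h1 : ∀ i, b.coord i = ∑ j, b.coord i (c j) • c.coord j := by
    intro i
    refine c.ext fun j => ?_
    simp [Finsupp.single_apply]
  have h2 : ∀ j, c j = ∑ i, b.coord i (c j) • b i := fun j => (b.sum_repr (c j)).symm
  change ∑ j, mk k H 1 (c j) ⊗ₜ[k] φ (c.coord j) = ∑ i, mk k H 1 (b i) ⊗ₜ[k] φ (b.coord i)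
  calc _ = ∑ j, ∑ i, mk k H 1 (b i) ⊗ₜ[k] (b.coord i (c j) • φ (c.coord j)) := by
        refine Finset.sum_congr rfl fun j _ => ?_
        conv_lhs => rw [h2 j]
        simp only [map_sum, map_smul, TensorProduct.sum_tmul, TensorProduct.smul_tmul]
    _ = _ := by
        rw [Finset.sum_comm]
        refine Finset.sum_congr rfl fun i _ => ?_
        conv_rhs => rw [h1 i]
        simp only [map_sum, map_smul, TensorProduct.tmul_sum]

end DrinfeldDouble

/-! ### Actions of the dual on a Hopf algebra -/

section actions
variable {k : Type*} {H : Type*} [Field k] [Ring H] [HopfAlgebra k H]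

/-- The left action `χ ⇀ h = ∑ h₁ χ(h₂)` of `H^*` on `H`. -/
noncomputable def leftHit (χ : HopfDual k H) (h : H) : H :=
  TensorProduct.rid k H ((HopfDual.toDual k H χ).lTensor H (comul h))

/-- The right action `h ↼ χ = ∑ χ(h₁) h₂` of `H^*` on `H`. -/
noncomputable def rightHit (h : H) (χ : HopfDual k H) : H :=
  TensorProduct.lid k H ((HopfDual.toDual k H χ).rTensor H (comul h))

end actions

/-! ### Normal Hopf subalgebras -/

section normal
variable (k : Type*) {A : Type*} [Field k] [Ring A] [HopfAlgebra k A]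

/-- The group algebra `⟨g⟩` generated by a group-like element `g`: the subalgebra generated by `g`
and its inverse `S g`. -/
noncomputable def groupLikeAlgebra (g : A) : Subalgebra k A := Algebra.adjoin k {g, antipode k g}

variable {k}

/-- A subalgebra `K` is a Hopf subalgebra if `Δ(K) ⊆ K ⊗ K` and `S(K) ⊆ K`. -/
structure IsHopfSubalgebra (K : Subalgebra k A) : Prop where
  comul_mem : ∀ z ∈ K, comul (R := k) z ∈
    LinearMap.range (TensorProduct.map K.val.toLinearMap K.val.toLinearMap)
  antipode_mem : ∀ z ∈ K, antipode k z ∈ K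

/-- A Hopf subalgebra `K` of `A` is normal if it is stable under the left and right adjoint actions
`z ↦ ∑ h₁ z S(h₂)` and `z ↦ ∑ S(h₁) z h₂` of `A`. -/
structure IsNormalHopfSubalgebra (K : Subalgebra k A) : Prop extends IsHopfSubalgebra K where
  adjoint_left_mem : ∀ h : A, ∀ z ∈ K, LinearMap.mul' k A
    (TensorProduct.map (LinearMap.mulRight k z) (antipode k) (comul h)) ∈ K
  adjoint_right_mem : ∀ h : A, ∀ z ∈ K, LinearMap.mul' k A
    (TensorProduct.map (LinearMap.mulRight k z ∘ₗ antipode k) LinearMap.id (comul h)) ∈ K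

/-- The left ideal `A K⁺` of `A`, where `K⁺` is the kernel of the counit of `K`. -/
def augmentationIdeal (K : Subalgebra k A) : Ideal A :=
  Ideal.span {z : A | z ∈ K ∧ counit (R := k) z = 0}

end normal

/-! ### Quasitriangular and factorizable Hopf algebras -/

section factorizable
variable {k : Type*} {A : Type*} [Field k] [Ring A] [HopfAlgebra k A]

/-- `(A, R)` is a quasitriangular Hopf algebra. The embeddings `R ↦ R₁₃` and `R ↦ R₂₃` are
the algebra maps `includeLeft ⊗ id` and `includeRight ⊗ id` to `(A ⊗ A) ⊗ A`, and `R₁₂ = R ⊗ 1`. -/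
structure IsQuasitriangular (R : A ⊗[k] A) : Prop where
  isUnit : IsUnit R
  comul_rTensor : (comul (R := k)).rTensor A R =
    Algebra.TensorProduct.map (Algebra.TensorProduct.includeLeft : A →ₐ[k] A ⊗[k] A)
      (AlgHom.id k A) R *
      Algebra.TensorProduct.map (Algebra.TensorProduct.includeRight : A →ₐ[k] A ⊗[k] A)
      (AlgHom.id k A) R
  comul_lTensor : (TensorProduct.assoc k A A A).symm ((comul (R := k)).lTensor A R) =
    Algebra.TensorProduct.map (Algebra.TensorProduct.includeLeft : A →ₐ[k] A ⊗[k] A)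
      (AlgHom.id k A) R *
      (R ⊗ₜ[k] (1 : A))
  comul_op_mul : ∀ h : A, TensorProduct.comm k A A (comul h) * R = R * comul h

/-- The linear map `f_Q : A^* → A`, `f_Q(a) = (a ⊗ id)(Q)`. -/
noncomputable def drinfeldMap (Q : A ⊗[k] A) : Module.Dual k A →ₗ[k] A where
  toFun a := TensorProduct.lid k A (a.rTensor A Q)
  map_add' a b := by rw [LinearMap.rTensor_add, LinearMap.add_apply, map_add]
  map_smul' r a := by rw [LinearMap.rTensor_smul, LinearMap.smul_apply, map_smul, RingHom.id_apply]

/-- `(A, R)` is a factorizable Hopf algebra: it is quasitriangular and `f_Q` is a linear isomorphism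
for `Q = R₂₁ R`. -/
structure IsFactorizable (R : A ⊗[k] A) : Prop extends IsQuasitriangular R where
  bijective : Function.Bijective (drinfeldMap (TensorProduct.comm k A A R * R))

end factorizable

/-!
Write `g = χx`, `K = ⟨g⟩` and `I = D(H) K⁺`.

*Centrality.* The two actions of `χ` on `H` commute, so `σ` and `τ` commute, and on the basis
`aᵢ xʲ` this gives the relation `x (χ ⇀ h) = (h ↼ χ) x` for all `h`
(`mul_leftHit_eq_rightHit_mul`). It is equivalent to the commutation of `g` with `H` and with `H^*`
in `D(H)` (`DrinfeldDouble.tmul_mem_center`). For a central group-like element it is formal that `K`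
is a normal Hopf subalgebra and that `I = D(H)(g - 1)` is a Hopf ideal.

*The double is factorizable.* The axioms of `R = ∑ bᵢ ⊗ βᵢ` are identities between sums over dual
bases; they reduce to `∑ Δ(bᵢ) ⊗ βᵢ = ∑ bᵢ ⊗ bⱼ ⊗ βᵢβⱼ`, to its dual, and to moving a linear map
of `H` across the canonical element (`DrinfeldDouble.isQuasitriangular_universalR`). The Drinfeld
map sends `p` to `∑ p(βᵢ bⱼ) bᵢ βⱼ`, and the `bᵢ βⱼ` are linearly independent
(`DrinfeldDouble.injective_drinfeldMap_universalR`).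

*The quotient is factorizable.* Quasitriangularity passes to quotients. For the Drinfeld map, let
`λ(f ⊗ h) = (x ⇀ f) ⊗ (h ↼ χ)`. Then `f_Q(p ∘ λ) = g f_Q(p)`, while `λ(g d) = χ(x)² g λ(d)`. If `p`
vanishes on `I` and `f_Q(p) ∈ I`, then `f_Q(∑ⱼ p ∘ λʲ) = ∑ⱼ gʲ f_Q(p) = 0`, so `∑ⱼ p ∘ λʲ = 0`.
The `p ∘ λʲ`, for `0 ≤ j < n`, are eigenvectors of translation by `g` with eigenvalues `χ(x)²ʲ`.
As `n` is odd these are distinct, so every summand is zero and `p = 0`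
(`IsGroupLikeElem.eq_zero_of_drinfeldMap_mem`).
-/

/-! ### Central group-like elements -/

section central
variable {k : Type*} {A : Type*} [Field k] [Ring A] [HopfAlgebra k A] {g : A}

theorem mem_groupLikeAlgebra (g : A) : g ∈ groupLikeAlgebra k g :=
  Algebra.subset_adjoin (by simp)

theorem antipode_mem_groupLikeAlgebra (g : A) : antipode k g ∈ groupLikeAlgebra k g :=
  Algebra.subset_adjoin (by simp)

theorem IsGroupLikeElem.isHopfSubalgebra (hg : IsGroupLikeElem k g) :
    IsHopfSubalgebra (groupLikeAlgebra k g) where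
  comul_mem z hz := by
    set K := groupLikeAlgebra k g with hK
    suffices h : K ≤ (Algebra.TensorProduct.map K.val K.val).range.comap
        (Bialgebra.comulAlgHom k A) from h hz
    refine Algebra.adjoin_le ?_
    rintro y (rfl | rfl)
    · refine ⟨⟨y, mem_groupLikeAlgebra y⟩ ⊗ₜ ⟨y, mem_groupLikeAlgebra y⟩, ?_⟩
      simp [hg.comul_eq_tmul_self]
    · refine ⟨⟨_, antipode_mem_groupLikeAlgebra g⟩ ⊗ₜ ⟨_, antipode_mem_groupLikeAlgebra g⟩, ?_⟩
      simp [hg.antipode.comul_eq_tmul_self]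
  antipode_mem z hz := by
    induction hz using Algebra.adjoin_induction with
    | mem y hy =>
      rcases hy with rfl | rfl
      · exact antipode_mem_groupLikeAlgebra y
      · rw [hg.antipode_antipode]; exact mem_groupLikeAlgebra g
    | algebraMap r =>
      rw [Algebra.algebraMap_eq_smul_one, map_smul, antipode_one]
      exact Subalgebra.smul_mem _ (one_mem _) r
    | add y w _ _ hy hw => rw [map_add]; exact add_mem hy hw
    | mul y w _ _ hy hw => rw [antipode_mul_antidistrib]; exact mul_mem hw hy

theorem IsGroupLikeElem.antipode_mem_center (hg : IsGroupLikeElem k g)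
    (hc : g ∈ Subalgebra.center k A) : antipode k g ∈ Subalgebra.center k A := by
  rw [Subalgebra.mem_center_iff] at hc ⊢
  intro b
  calc b * antipode k g = antipode k g * (g * b) * antipode k g := by
        rw [← mul_assoc, hg.antipode_mul_cancel, one_mul]
    _ = antipode k g * b := by
        rw [← hc b, mul_assoc, mul_assoc, hg.mul_antipode_cancel, mul_one]

theorem IsGroupLikeElem.groupLikeAlgebra_le_center (hg : IsGroupLikeElem k g)
    (hc : g ∈ Subalgebra.center k A) : groupLikeAlgebra k g ≤ Subalgebra.center k A := by
  refine Algebra.adjoin_le ?_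
  rintro y (rfl | rfl)
  exacts [hc, hg.antipode_mem_center hc]

/-- Both adjoint actions on a central element are given by the counit. -/
theorem IsHopfSubalgebra.isNormal {K : Subalgebra k A} (hK : IsHopfSubalgebra K)
    (hc : K ≤ Subalgebra.center k A) : IsNormalHopfSubalgebra K where
  toIsHopfSubalgebra := hK
  adjoint_left_mem h z hz := by
    have hz' := Subalgebra.mem_center_iff.1 (hc hz)
    have e : LinearMap.mul' k A ∘ₗ TensorProduct.map (LinearMap.mulRight k z) (antipode k) =
        LinearMap.mulLeft k z ∘ₗ LinearMap.mul' k A ∘ₗ (antipode k).lTensor A :=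
      TensorProduct.ext' fun u v => by simp [hz' u, mul_assoc]
    have e' := LinearMap.congr_fun e (comul h)
    simp only [LinearMap.comp_apply, mul_antipode_lTensor_comul_apply] at e'
    rw [e', LinearMap.mulLeft_apply]
    exact mul_mem hz (algebraMap_mem _ _)
  adjoint_right_mem h z hz := by
    have hz' := Subalgebra.mem_center_iff.1 (hc hz)
    have e : LinearMap.mul' k A ∘ₗ
          TensorProduct.map (LinearMap.mulRight k z ∘ₗ antipode k) LinearMap.id =
        LinearMap.mulLeft k z ∘ₗ LinearMap.mul' k A ∘ₗ (antipode k).rTensor A :=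
      TensorProduct.ext' fun u v => by simp [hz', mul_assoc]
    have e' := LinearMap.congr_fun e (comul h)
    simp only [LinearMap.comp_apply, mul_antipode_rTensor_comul_apply] at e'
    rw [e', LinearMap.mulLeft_apply]
    exact mul_mem hz (algebraMap_mem _ _)

/-- The ideal `A ⟨g⟩⁺` is generated by `g - 1`. -/
theorem IsGroupLikeElem.augmentationIdeal_eq (hg : IsGroupLikeElem k g) :
    augmentationIdeal (groupLikeAlgebra k g) = Ideal.span {g - 1} := by
  refine le_antisymm (Ideal.span_le.2 ?_) (Ideal.span_le.2 ?_)
  · rintro z ⟨hz, hz0⟩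
    suffices h : z - algebraMap k A (counit z) ∈ Ideal.span {g - 1} by simpa [hz0] using h
    clear hz0
    induction hz using Algebra.adjoin_induction with
    | mem y hy =>
      rcases hy with rfl | rfl
      · rw [hg.counit_eq_one, map_one]; exact Ideal.subset_span rfl
      · rw [hg.antipode.counit_eq_one, map_one]
        refine Ideal.mem_span_singleton'.2 ⟨-antipode k g, ?_⟩
        rw [neg_mul, mul_sub, hg.antipode_mul_cancel, mul_one, neg_sub]
    | algebraMap r => simp
    | add y w _ _ hy hw =>
      rw [map_add, map_add, add_sub_add_comm]; exact add_mem hy hw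
    | mul y w _ _ hy hw =>
      have e : y * w - algebraMap k A (counit (y * w)) =
          y * (w - algebraMap k A (counit w)) +
            algebraMap k A (counit w) * (y - algebraMap k A (counit y)) := by
        rw [Bialgebra.counit_mul, map_mul, mul_sub, mul_sub, Algebra.commutes (counit w) y,
          Algebra.commutes (counit w) (algebraMap k A (counit y))]
        abel
      rw [e]
      exact add_mem (Ideal.mul_mem_left _ _ hw) (Ideal.mul_mem_left _ _ hy)
  · rintro _ rfl
    exact Ideal.subset_span ⟨sub_mem (mem_groupLikeAlgebra g) (one_mem _), by
      simp [hg.counit_eq_one]⟩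

theorem IsGroupLikeElem.mem_augmentationIdeal (hg : IsGroupLikeElem k g) {z : A} :
    z ∈ augmentationIdeal (groupLikeAlgebra k g) ↔ ∃ a, a * (g - 1) = z := by
  rw [hg.augmentationIdeal_eq, Ideal.mem_span_singleton']

theorem IsGroupLikeElem.isTwoSided_augmentationIdeal (hg : IsGroupLikeElem k g)
    (hc : g ∈ Subalgebra.center k A) :
    (augmentationIdeal (groupLikeAlgebra k g)).IsTwoSided where
  mul_mem_of_left {z} b hz := by
    rw [hg.mem_augmentationIdeal] at hz ⊢
    obtain ⟨a, rfl⟩ := hz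
    refine ⟨a * b, ?_⟩
    rw [mul_assoc, mul_assoc, mul_sub, sub_mul, Subalgebra.mem_center_iff.1 hc b, mul_one, one_mul]

theorem IsGroupLikeElem.isHopfIdeal_augmentationIdeal (hg : IsGroupLikeElem k g)
    [htwo : (augmentationIdeal (groupLikeAlgebra k g)).IsTwoSided] :
    (augmentationIdeal (groupLikeAlgebra k g)).IsHopfIdeal k where
  counit_eq_zero z hz := by
    obtain ⟨a, rfl⟩ := hg.mem_augmentationIdeal.1 hz
    simp [hg.counit_eq_one]
  map_mkQ_comul_eq_zero z hz := by
    obtain ⟨a, rfl⟩ := hg.mem_augmentationIdeal.1 hz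
    set I := augmentationIdeal (groupLikeAlgebra k g)
    change Algebra.TensorProduct.map (Ideal.Quotient.mkₐ k I) (Ideal.Quotient.mkₐ k I)
      (comul (R := k) (a * (g - 1))) = 0
    have h1 : Ideal.Quotient.mkₐ k I g = 1 :=
      Ideal.Quotient.eq.2 (hg.mem_augmentationIdeal.2 ⟨1, one_mul _⟩)
    rw [Bialgebra.comul_mul, map_mul, map_sub, map_sub, hg.comul_eq_tmul_self, Bialgebra.comul_one,
      map_one, Algebra.TensorProduct.map_tmul, h1, ← Algebra.TensorProduct.one_def, sub_self,
      mul_zero]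
  antipode_mem z hz := by
    obtain ⟨a, rfl⟩ := hg.mem_augmentationIdeal.1 hz
    rw [antipode_mul_antidistrib]
    refine Ideal.mul_mem_right _ _ (hg.mem_augmentationIdeal.2 ⟨-antipode k g, ?_⟩)
    rw [neg_mul, mul_sub, hg.antipode_mul_cancel, mul_one, neg_sub, map_sub, antipode_one]

end central

/-! ### Quotients of quasitriangular Hopf algebras -/

section quotient
variable {k : Type*} {A B : Type*} [Field k] [Ring A] [HopfAlgebra k A] [Ring B] [HopfAlgebra k B]

theorem TensorProduct.comm_map_mul_map (π : A →ₐ[k] B) (R : A ⊗[k] A) :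
    TensorProduct.comm k B B (TensorProduct.map π.toLinearMap π.toLinearMap R) *
        TensorProduct.map π.toLinearMap π.toLinearMap R =
      TensorProduct.map π.toLinearMap π.toLinearMap (TensorProduct.comm k A A R * R) := by
  rw [← TensorProduct.map_comm]
  exact (map_mul (Algebra.TensorProduct.map π π) _ _).symm

theorem IsQuasitriangular.map {R : A ⊗[k] A} (hR : IsQuasitriangular R) (π : A →ₐ[k] B)
    (hπ : Function.Surjective π)
    (hΔ : ∀ a, comul (R := k) (π a) = TensorProduct.map π.toLinearMap π.toLinearMap (comul a)) :
    IsQuasitriangular (TensorProduct.map π.toLinearMap π.toLinearMap R) := by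
  let P := Algebra.TensorProduct.map π π
  let P3 := Algebra.TensorProduct.map P π
  have hP : ∀ z, TensorProduct.map π.toLinearMap π.toLinearMap z = P z := fun z => rfl
  have h13 : ∀ z, Algebra.TensorProduct.map (Algebra.TensorProduct.includeLeft : B →ₐ[k] B ⊗[k] B)
      (AlgHom.id k B) (P z) = P3 (Algebra.TensorProduct.map
        (Algebra.TensorProduct.includeLeft : A →ₐ[k] A ⊗[k] A) (AlgHom.id k A) z) := by
    intro z
    induction z using TensorProduct.induction_on with
    | zero => simp
    | add y w hy hw => simp only [map_add, hy, hw]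
    | tmul u v => simp [P, P3]
  have h23 : ∀ z, Algebra.TensorProduct.map (Algebra.TensorProduct.includeRight : B →ₐ[k] B ⊗[k] B)
      (AlgHom.id k B) (P z) = P3 (Algebra.TensorProduct.map
        (Algebra.TensorProduct.includeRight : A →ₐ[k] A ⊗[k] A) (AlgHom.id k A) z) := by
    intro z
    induction z using TensorProduct.induction_on with
    | zero => simp
    | add y w hy hw => simp only [map_add, hy, hw]
    | tmul u v => simp [P, P3]
  have hr : ∀ z, (comul (R := k)).rTensor B (P z) = P3 ((comul (R := k)).rTensor A z) := by
    intro z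
    induction z using TensorProduct.induction_on with
    | zero => simp
    | add y w hy hw => simp only [map_add, hy, hw]
    | tmul u v => simp [P, P3, hΔ, hP]
  have hassoc : ∀ (u : A) (z : A ⊗[k] A), (TensorProduct.assoc k B B B).symm (π u ⊗ₜ P z) =
      P3 ((TensorProduct.assoc k A A A).symm (u ⊗ₜ z)) := by
    intro u z
    induction z using TensorProduct.induction_on with
    | zero => simp
    | add y w hy hw => simp only [map_add, TensorProduct.tmul_add, hy, hw]
    | tmul v w => simp [P, P3]
  have hl : ∀ z, (TensorProduct.assoc k B B B).symm ((comul (R := k)).lTensor B (P z)) =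
      P3 ((TensorProduct.assoc k A A A).symm ((comul (R := k)).lTensor A z)) := by
    intro z
    induction z using TensorProduct.induction_on with
    | zero => simp
    | add y w hy hw => simp only [map_add, hy, hw]
    | tmul u v =>
      rw [LinearMap.lTensor_tmul, ← hassoc, ← hP (comul v), ← hΔ]
      simp [P]
  refine ⟨?_, ?_, ?_, ?_⟩
  · exact hR.isUnit.map P
  · rw [hP, h13, h23, ← map_mul, ← hR.comul_rTensor]
    exact hr R
  · have h12 : P R ⊗ₜ[k] (1 : B) = P3 (R ⊗ₜ[k] (1 : A)) := by simp [P3]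
    rw [hP, h13, h12, ← map_mul, ← hR.comul_lTensor]
    exact hl R
  · intro h
    obtain ⟨a, rfl⟩ := hπ h
    have hcomm : ∀ z, TensorProduct.comm k B B (P z) = P (TensorProduct.comm k A A z) := by
      intro z
      induction z using TensorProduct.induction_on with
      | zero => simp
      | add y w hy hw => simp only [map_add, hy, hw]
      | tmul u v => simp [P]
    rw [hΔ, hP, hP, hcomm, ← map_mul, hR.comul_op_mul, map_mul]

/-- `f_Q` is natural: for `π : A → B`, the Drinfeld map of the image of `Q` is `π ∘ f_Q ∘ π^*`. -/
theorem drinfeldMap_map (Q : A ⊗[k] A) (π : A →ₐ[k] B) (p : Module.Dual k B) :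
    drinfeldMap (TensorProduct.map π.toLinearMap π.toLinearMap Q) p =
      π (drinfeldMap Q (p ∘ₗ π.toLinearMap)) := by
  change TensorProduct.lid k B (p.rTensor B _) =
    π (TensorProduct.lid k A ((p ∘ₗ π.toLinearMap).rTensor A Q))
  induction Q using TensorProduct.induction_on with
  | zero => simp
  | add y w hy hw => simp only [map_add, hy, hw]
  | tmul u v => simp

end quotient

/-! ### Averaging over a cyclic group of central group-like elements -/

section averaging
variable {k : Type*} {A : Type*} [Field k] [Ring A] [HopfAlgebra k A] {g : A}

theorem IsGroupLikeElem.geom_sum_mul_eq_zero (hg : IsGroupLikeElem k g)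
    (hc : g ∈ Subalgebra.center k A) {n : ℕ} (hn : g ^ n = 1)
    {z : A} (hz : z ∈ augmentationIdeal (groupLikeAlgebra k g)) :
    ∑ j ∈ Finset.range n, g ^ j * z = 0 := by
  obtain ⟨a, rfl⟩ := hg.mem_augmentationIdeal.1 hz
  have h : (∑ j ∈ Finset.range n, g ^ j) * (g - 1) = 0 := by rw [geom_sum_mul, hn, sub_self]
  have h' : ∀ j, g ^ j * (a * (g - 1)) = a * (g ^ j * (g - 1)) := by
    intro j
    rw [← mul_assoc, ← mul_assoc, Subalgebra.mem_center_iff.1 (pow_mem hc j) a]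
  simp only [h']
  rw [← Finset.mul_sum, ← Finset.sum_mul, h, mul_zero]

/-- Suppose that precomposition with `lam` corresponds, under an injective Drinfeld map, to
multiplication by a central group-like `g` of order dividing `n`, and that `lam` scales
multiplication by `g` by a primitive `n`-th root of unity. If `p` is `g`-invariant, the functionals
`p ∘ lam ^ j` lie in distinct eigenspaces of `g`, so that `f_Q(p) ∈ A ⟨g⟩⁺` forces `p = 0`. -/
theorem IsGroupLikeElem.eq_zero_of_drinfeldMap_mem [CharZero k] (hg : IsGroupLikeElem k g)
    (hc : g ∈ Subalgebra.center k A) {n : ℕ} (hn0 : n ≠ 0) (hn : g ^ n = 1)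
    {Q : A ⊗[k] A} (hQ : Function.Injective (drinfeldMap Q)) (lam : Module.End k A)
    (hlam : ∀ p : Module.Dual k A, drinfeldMap Q (p ∘ₗ lam) = g * drinfeldMap Q p)
    {ζ : k} (hζ : IsPrimitiveRoot ζ n) (hgl : ∀ a, lam (g * a) = ζ • (g * lam a))
    (p : Module.Dual k A) (hp : ∀ a, p (g * a) = p a)
    (hmem : drinfeldMap Q p ∈ augmentationIdeal (groupLikeAlgebra k g)) : p = 0 := by
  have h1 : ∀ j, drinfeldMap Q (p ∘ₗ lam ^ j) = g ^ j * drinfeldMap Q p := by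
    intro j
    induction j with
    | zero => rw [pow_zero, pow_zero, one_mul]; rfl
    | succ j ih =>
      have e : p ∘ₗ lam ^ (j + 1) = (p ∘ₗ lam ^ j) ∘ₗ lam := by
        rw [pow_succ, LinearMap.comp_assoc]; rfl
      rw [e, hlam, ih, pow_succ', mul_assoc]
  have h2 : ∑ j ∈ Finset.range n, p ∘ₗ lam ^ j = 0 := by
    apply hQ
    rw [map_sum, map_zero]
    simp only [h1]
    exact hg.geom_sum_mul_eq_zero hc hn hmem
  have h3 : ∀ j a, p ((lam ^ j) (g * a)) = ζ ^ j * p ((lam ^ j) a) := by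
    intro j
    have : ∀ a, (lam ^ j) (g * a) = ζ ^ j • (g * (lam ^ j) a) := by
      induction j with
      | zero => simp
      | succ j ih =>
        intro a
        rw [pow_succ, Module.End.mul_apply, Module.End.mul_apply, hgl, map_smul, ih, smul_smul,
          ← pow_succ']
    intro a
    rw [this, map_smul, hp, smul_eq_mul]
  have h4 : ∀ i j a, p ((lam ^ j) (g ^ i * a)) = (ζ ^ j) ^ i * p ((lam ^ j) a) := by
    intro i j
    induction i with
    | zero => simp
    | succ i ih => intro a; rw [pow_succ, mul_assoc, ih, h3, ← mul_assoc, ← pow_succ]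
  ext a
  have h5 : ∑ i ∈ Finset.range n, ∑ j ∈ Finset.range n, (ζ ^ j) ^ i * p ((lam ^ j) a) = 0 := by
    refine Finset.sum_eq_zero fun i _ => ?_
    have := LinearMap.congr_fun h2 (g ^ i * a)
    simpa [LinearMap.sum_apply, h4] using this
  -- Summing over `i` isolates the eigenvalue `1`, that is, the index `j = 0`.
  rw [Finset.sum_comm, Finset.sum_eq_single 0] at h5
  · simpa [hn0] using h5
  · intro j hj hj0
    have hne : ζ ^ j ≠ 1 := hζ.pow_ne_one_of_pos_of_lt hj0 (Finset.mem_range.1 hj)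
    have hz : ∑ i ∈ Finset.range n, (ζ ^ j) ^ i = 0 := by
      rw [geom_sum_eq hne, ← pow_mul, mul_comm, pow_mul, hζ.pow_eq_one, one_pow, sub_self, zero_div]
    rw [← Finset.sum_mul, hz, zero_mul]
  · intro h; exact absurd (Finset.mem_range.2 (Nat.pos_of_ne_zero hn0)) h

/-- Under the hypotheses of `IsGroupLikeElem.eq_zero_of_drinfeldMap_mem`, the Drinfeld map of
`A / A ⟨g⟩⁺` is injective, hence bijective by a dimension count. -/
theorem IsGroupLikeElem.isFactorizable_quotient [CharZero k] [FiniteDimensional k A]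
    (hg : IsGroupLikeElem k g) (hc : g ∈ Subalgebra.center k A) {n : ℕ} (hn0 : n ≠ 0)
    (hn : g ^ n = 1) {R : A ⊗[k] A} (hR : IsQuasitriangular R)
    (hQ : Function.Injective (drinfeldMap (TensorProduct.comm k A A R * R))) (lam : Module.End k A)
    (hlam : ∀ p : Module.Dual k A, drinfeldMap (TensorProduct.comm k A A R * R) (p ∘ₗ lam) =
      g * drinfeldMap (TensorProduct.comm k A A R * R) p)
    {ζ : k} (hζ : IsPrimitiveRoot ζ n) (hgl : ∀ a, lam (g * a) = ζ • (g * lam a))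
    [(augmentationIdeal (groupLikeAlgebra k g)).IsTwoSided]
    [(augmentationIdeal (groupLikeAlgebra k g)).IsHopfIdeal k] :
    IsFactorizable (A := A ⧸ augmentationIdeal (groupLikeAlgebra k g))
      (TensorProduct.map (Ideal.Quotient.mkₐ k (augmentationIdeal (groupLikeAlgebra k g))).toLinearMap
        (Ideal.Quotient.mkₐ k (augmentationIdeal (groupLikeAlgebra k g))).toLinearMap R) := by
  set π := Ideal.Quotient.mkₐ k (augmentationIdeal (groupLikeAlgebra k g))
  have hπ : Function.Surjective π := Ideal.Quotient.mkₐ_surjective k _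
  refine ⟨hR.map π hπ fun _ => rfl, ?_⟩
  rw [TensorProduct.comm_map_mul_map]
  suffices hinj : Function.Injective (drinfeldMap
      (TensorProduct.map π.toLinearMap π.toLinearMap (TensorProduct.comm k A A R * R))) by
    have : FiniteDimensional k (A ⧸ augmentationIdeal (groupLikeAlgebra k g)) :=
      Module.Finite.of_surjective π.toLinearMap hπ
    exact ⟨hinj, (LinearMap.injective_iff_surjective_of_finrank_eq_finrank
      Subspace.dual_finrank_eq).1 hinj⟩
  rw [injective_iff_map_eq_zero]
  intro p hp
  rw [drinfeldMap_map] at hp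
  have hπg : π g = 1 := Ideal.Quotient.eq.2 (hg.mem_augmentationIdeal.2 ⟨1, one_mul _⟩)
  have h0 := hg.eq_zero_of_drinfeldMap_mem hc hn0 hn hQ lam hlam hζ hgl (p ∘ₗ π.toLinearMap)
    (fun d => by simp [hπg]) (Ideal.Quotient.eq_zero_iff_mem.1 hp)
  refine LinearMap.ext fun y => ?_
  obtain ⟨d, rfl⟩ := hπ y
  exact LinearMap.congr_fun h0 d

end averaging

/-! ### The universal R-matrix of the Drinfeld double -/

namespace DrinfeldDouble
variable {k : Type*} {H : Type*} [Field k] [Ring H] [HopfAlgebra k H]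

/-- The basis of `H^*` dual to the basis `T.b` of `H`. -/
noncomputable def dualBasis {n : ℕ} (T : Coeff k H n) (i : Fin n) : HopfDual k H :=
  (HopfDual.toDual k H).symm (T.b.coord i)

variable {n : ℕ} (T : Coeff k H n)

theorem dualBasis_b (i j : Fin n) : dualBasis T i (T.b j) = if i = j then 1 else 0 := by
  simp [dualBasis, Finsupp.single_apply, eq_comm]

theorem sum_dualBasis_smul (h : H) : ∑ i, dualBasis T i h • T.b i = h := T.b.sum_repr h

theorem sum_smul_dualBasis (f : HopfDual k H) : ∑ i, f (T.b i) • dualBasis T i = f := by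
  apply (HopfDual.toDual k H).injective
  refine T.b.ext fun j => ?_
  simp [dualBasis_b]

/-- The canonical element `∑ bᵢ ⊗ βᵢ` intertwines a linear map with its transpose. -/
theorem sum_transpose {M : Type*} [AddCommMonoid M] [Module k M]
    (B : HopfDual k H →ₗ[k] H →ₗ[k] M) (φ : H →ₗ[k] H) :
    ∑ i, B (dualBasis T i) (φ (T.b i)) =
      ∑ i, B ((HopfDual.toDual k H).symm (HopfDual.toDual k H (dualBasis T i) ∘ₗ φ)) (T.b i) := by
  calc _ = ∑ i, ∑ j, dualBasis T j (φ (T.b i)) • B (dualBasis T i) (T.b j) := by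
        refine Finset.sum_congr rfl fun i _ => ?_
        conv_lhs => rw [← sum_dualBasis_smul T (φ (T.b i))]
        simp
    _ = _ := by
        rw [Finset.sum_comm]
        refine Finset.sum_congr rfl fun j _ => ?_
        conv_rhs => rw [← sum_smul_dualBasis T
          ((HopfDual.toDual k H).symm (HopfDual.toDual k H (dualBasis T j) ∘ₗ φ))]
        simp [LinearMap.sum_apply]

theorem dualBasis_mul (p q : Fin n) :
    dualBasis T p * dualBasis T q = ∑ i, dualBasis T p (T.t i q) • dualBasis T i := by
  rw [← sum_smul_dualBasis T (dualBasis T p * dualBasis T q)]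
  refine Finset.sum_congr rfl fun i _ => ?_
  rw [HopfDual.mul_apply, T.comul_b]
  simp [dualBasis_b]

/-- `∑ᵢ Δ(bᵢ) ⊗ βᵢ = ∑ᵢⱼ bᵢ ⊗ bⱼ ⊗ βᵢ βⱼ`. -/
theorem sum_comul_tmul {M : Type*} [AddCommMonoid M] [Module k M]
    (B : H ⊗[k] H →ₗ[k] HopfDual k H →ₗ[k] M) :
    ∑ i, B (comul (T.b i)) (dualBasis T i) =
      ∑ i, ∑ j, B (T.b i ⊗ₜ T.b j) (dualBasis T i * dualBasis T j) := by
  simp only [dualBasis_mul, map_sum, map_smul]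
  calc _ = ∑ i, ∑ j, ∑ l, dualBasis T l (T.t i j) • B (T.b l ⊗ₜ T.b j) (dualBasis T i) := by
        refine Finset.sum_congr rfl fun i _ => ?_
        rw [T.comul_b, map_sum, LinearMap.sum_apply]
        refine Finset.sum_congr rfl fun j _ => ?_
        conv_lhs => rw [← sum_dualBasis_smul T (T.t i j)]
        simp only [TensorProduct.sum_tmul, map_sum, ← TensorProduct.smul_tmul', map_smul,
          LinearMap.sum_apply, LinearMap.smul_apply]
    _ = ∑ l, ∑ i, ∑ j, dualBasis T l (T.t i j) • B (T.b l ⊗ₜ T.b j) (dualBasis T i) :=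
        (Finset.sum_congr rfl fun _ _ => Finset.sum_comm).trans Finset.sum_comm
    _ = _ := Finset.sum_congr rfl fun _ _ => Finset.sum_comm

variable [FiniteDimensional k H]

theorem comul_eq_sum_dualBasis (f : HopfDual k H) : comul (R := k) f =
    ∑ p, ∑ q, f (T.b p * T.b q) • (dualBasis T p ⊗ₜ[k] dualBasis T q) := by
  refine HopfDual.pair_ext fun c d => ?_
  rw [HopfDual.evalLeft_comul]
  conv_lhs => rw [← sum_dualBasis_smul T c, ← sum_dualBasis_smul T d]
  simp only [map_sum, HopfDual.sum_apply, map_smul, HopfDual.smul_apply, HopfDual.evalLeft_tmul,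
    Finset.sum_mul_sum, smul_mul_assoc, mul_smul_comm, smul_eq_mul]
  refine Finset.sum_congr rfl fun i _ => Finset.sum_congr rfl fun j _ => ?_
  ring

variable (k H) in
/-- The embedding `h ↦ ε ⊗ h` of `H` into `D(H)`. -/
noncomputable def inr : H →ₐ[k] DrinfeldDouble k H :=
  AlgHom.ofLinearMap (mk k H 1) rfl fun u v => (mul_one_tmul 1 u v).symm

variable (k H) in
/-- The embedding `f ↦ f ⊗ 1` of `H^*` into `D(H)`. -/
noncomputable def inl : HopfDual k H →ₐ[k] DrinfeldDouble k H :=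
  AlgHom.ofLinearMap ((mk k H).flip 1) rfl fun f g => (tmul_one_mul f g 1).symm

theorem inr_apply (h : H) : inr k H h = tmul 1 h := rfl

theorem inl_apply (f : HopfDual k H) : inl k H f = tmul f 1 := rfl

theorem inl_mul_inr (f : HopfDual k H) (h : H) : inl k H f * inr k H h = tmul f h :=
  (tmul_eq f h).symm

theorem inr_t_mul_inl (i j : Fin n) (f : HopfDual k H) : inr k H (T.t i j) * inl k H f =
    ∑ a, ∑ b, tmul (biHit k H (T.t i a) (antipodeInv k H (T.t b j)) f) (T.t a b) := by
  rw [inr_apply, inl_apply, mul_t_tmul T]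
  simp

theorem comul_inr (h : H) : comul (R := k) (inr k H h) =
    TensorProduct.map (inr k H).toLinearMap (inr k H).toLinearMap (comul h) := by
  rw [inr_apply, comul_tmul, Bialgebra.comul_one, Algebra.TensorProduct.one_def]
  generalize comul (R := k) h = z
  induction z using TensorProduct.induction_on with
  | zero => simp
  | add y w hy hw => simp only [map_add, hy, hw]
  | tmul u v => rfl

theorem comul_inl (f : HopfDual k H) : comul (R := k) (inl k H f) =
    TensorProduct.map (inl k H).toLinearMap (inl k H).toLinearMap
      (TensorProduct.comm k _ _ (comul f)) := by
  rw [inl_apply, comul_tmul, Bialgebra.comul_one, Algebra.TensorProduct.one_def]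
  generalize comul (R := k) f = z
  induction z using TensorProduct.induction_on with
  | zero => simp
  | add y w hy hw => simp only [map_add, hy, hw, LinearMap.add_apply]
  | tmul u v => rfl

theorem universalR_eq_sum : universalR k H = ∑ i, inr k H (T.b i) ⊗ₜ[k] inl k H (dualBasis T i) :=
  universalR_eq T.b

/-- `∑ᵢ bᵢ ⊗ Δ(βᵢ) = ∑ᵢⱼ bᵢ bⱼ ⊗ βᵢ ⊗ βⱼ`. -/
theorem sum_tmul_comul {M : Type*} [AddCommMonoid M] [Module k M]
    (B : H →ₗ[k] HopfDual k H ⊗[k] HopfDual k H →ₗ[k] M) :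
    ∑ i, B (T.b i) (comul (dualBasis T i)) =
      ∑ i, ∑ j, B (T.b i * T.b j) (dualBasis T i ⊗ₜ dualBasis T j) := by
  calc _ = ∑ i, ∑ p, ∑ q, dualBasis T i (T.b p * T.b q) •
          B (T.b i) (dualBasis T p ⊗ₜ dualBasis T q) := by
        refine Finset.sum_congr rfl fun i _ => ?_
        rw [comul_eq_sum_dualBasis T]
        simp only [map_sum, map_smul]
    _ = ∑ p, ∑ q, ∑ i, dualBasis T i (T.b p * T.b q) •
          B (T.b i) (dualBasis T p ⊗ₜ dualBasis T q) := by
        rw [Finset.sum_comm]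
        exact Finset.sum_congr rfl fun _ _ => Finset.sum_comm
    _ = _ := by
        refine Finset.sum_congr rfl fun p _ => Finset.sum_congr rfl fun q _ => ?_
        conv_rhs => rw [← sum_dualBasis_smul T (T.b p * T.b q)]
        simp only [map_sum, map_smul, LinearMap.sum_apply, LinearMap.smul_apply]

theorem comul_rTensor_universalR : (comul (R := k)).rTensor _ (universalR k H) =
    Algebra.TensorProduct.map (Algebra.TensorProduct.includeLeft :
        DrinfeldDouble k H →ₐ[k] DrinfeldDouble k H ⊗[k] DrinfeldDouble k H)
      (AlgHom.id k _) (universalR k H) *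
    Algebra.TensorProduct.map (Algebra.TensorProduct.includeRight :
        DrinfeldDouble k H →ₐ[k] DrinfeldDouble k H ⊗[k] DrinfeldDouble k H)
      (AlgHom.id k _) (universalR k H) := by
  obtain ⟨n, ⟨T⟩⟩ := exists_coeff (k := k) (C := H)
  rw [universalR_eq_sum T]
  simp only [map_sum, LinearMap.rTensor_tmul, comul_inr, Finset.sum_mul_sum,
    Algebra.TensorProduct.map_tmul, Algebra.TensorProduct.tmul_mul_tmul,
    Algebra.TensorProduct.includeLeft_apply, Algebra.TensorProduct.includeRight_apply, one_mul,
    mul_one, AlgHom.id_apply, ← map_mul]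
  exact sum_comul_tmul T ((TensorProduct.mk k _ _).compl₁₂
    (TensorProduct.map (inr k H).toLinearMap (inr k H).toLinearMap) (inl k H).toLinearMap)

theorem comul_lTensor_universalR :
    (TensorProduct.assoc k _ _ _).symm ((comul (R := k)).lTensor _ (universalR k H)) =
    Algebra.TensorProduct.map (Algebra.TensorProduct.includeLeft :
        DrinfeldDouble k H →ₐ[k] DrinfeldDouble k H ⊗[k] DrinfeldDouble k H)
      (AlgHom.id k _) (universalR k H) * (universalR k H ⊗ₜ[k] (1 : DrinfeldDouble k H)) := by
  obtain ⟨n, ⟨T⟩⟩ := exists_coeff (k := k) (C := H)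
  rw [universalR_eq_sum T]
  simp only [map_sum, LinearMap.lTensor_tmul, comul_inl, Finset.sum_mul_sum,
    Algebra.TensorProduct.map_tmul, Algebra.TensorProduct.tmul_mul_tmul, TensorProduct.sum_tmul,
    Algebra.TensorProduct.includeLeft_apply, one_mul, mul_one, AlgHom.id_apply, ← map_mul]
  refine (sum_tmul_comul T ((TensorProduct.mk k _ _).compl₁₂ (inr k H).toLinearMap
    (TensorProduct.map (inl k H).toLinearMap (inl k H).toLinearMap ∘ₗ
      (TensorProduct.comm k _ _).toLinearMap) |>.compr₂
        (TensorProduct.assoc k _ _ _).symm.toLinearMap)).trans ?_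
  simp

theorem isUnit_universalR : IsUnit (universalR k H) := by
  obtain ⟨n, ⟨T⟩⟩ := exists_coeff (k := k) (C := H)
  have h0 : ∑ i, algebraMap k (DrinfeldDouble k H) (counit (T.b i)) ⊗ₜ[k] inl k H (dualBasis T i) =
      1 := by
    have h : ∑ i, counit (R := k) (T.b i) • dualBasis T i = 1 := sum_smul_dualBasis T 1
    simp only [Algebra.algebraMap_eq_smul_one, TensorProduct.smul_tmul, ← map_smul]
    rw [← TensorProduct.tmul_sum, ← map_sum, h, map_one, Algebra.TensorProduct.one_def]
  refine isUnit_iff_exists.2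
    ⟨∑ i, inr k H (antipode k (T.b i)) ⊗ₜ[k] inl k H (dualBasis T i), ?_, ?_⟩
  · rw [universalR_eq_sum T, ← h0]
    simp only [Finset.sum_mul_sum, Algebra.TensorProduct.tmul_mul_tmul, ← map_mul]
    refine (sum_comul_tmul T ((TensorProduct.mk k _ _).compl₁₂
      ((inr k H).toLinearMap ∘ₗ LinearMap.mul' k H ∘ₗ (antipode k).lTensor H)
        (inl k H).toLinearMap)).symm.trans ?_
    simp
  · rw [universalR_eq_sum T, ← h0]
    simp only [Finset.sum_mul_sum, Algebra.TensorProduct.tmul_mul_tmul, ← map_mul]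
    refine (sum_comul_tmul T ((TensorProduct.mk k _ _).compl₁₂
      ((inr k H).toLinearMap ∘ₗ LinearMap.mul' k H ∘ₗ (antipode k).rTensor H)
        (inl k H).toLinearMap)).symm.trans ?_
    simp

theorem comul_eq_sum_tmul_dualBasis (f : HopfDual k H) :
    comul (R := k) f = ∑ q, biHit k H (T.b q) 1 f ⊗ₜ[k] dualBasis T q := by
  rw [comul_eq_sum_dualBasis T, Finset.sum_comm]
  refine Finset.sum_congr rfl fun q _ => ?_
  rw [← sum_smul_dualBasis T (biHit k H (T.b q) 1 f), TensorProduct.sum_tmul]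
  simp [TensorProduct.smul_tmul']

theorem comul_eq_sum_dualBasis_tmul (f : HopfDual k H) :
    comul (R := k) f = ∑ p, dualBasis T p ⊗ₜ[k] biHit k H 1 (T.b p) f := by
  rw [comul_eq_sum_dualBasis T]
  refine Finset.sum_congr rfl fun p _ => ?_
  rw [← sum_smul_dualBasis T (biHit k H 1 (T.b p) f), TensorProduct.tmul_sum]
  simp

/-- `∑ h₁ (f ↼ h₂) = ∑ (h₁ ⇀ f) h₂` in `D(H)`. -/
theorem mul_biHit_comul (f : HopfDual k H) (h : H) :
    TensorProduct.lift ((LinearMap.mul k (DrinfeldDouble k H)).compl₁₂ (inr k H).toLinearMap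
      ((inl k H).toLinearMap ∘ₗ (LinearMap.applyₗ f ∘ₗ biHit k H 1))) (comul h) =
    TensorProduct.lift ((mk k H).compl₁₂ (LinearMap.applyₗ f ∘ₗ (biHit k H).flip 1)
      LinearMap.id) (comul h) := by
  obtain ⟨n, ⟨T⟩⟩ := exists_coeff (k := k) (C := H)
  suffices e : TensorProduct.lift ((LinearMap.mul k (DrinfeldDouble k H)).compl₁₂
        (inr k H).toLinearMap
        ((inl k H).toLinearMap ∘ₗ (LinearMap.applyₗ f ∘ₗ biHit k H 1))) ∘ₗ comul =
      TensorProduct.lift ((mk k H).compl₁₂ (LinearMap.applyₗ f ∘ₗ (biHit k H).flip 1)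
        LinearMap.id) ∘ₗ comul from LinearMap.congr_fun e h
  refine T.ext fun i j => ?_
  simp only [LinearMap.comp_apply, T.comul_t, map_sum, TensorProduct.lift.tmul,
    LinearMap.compl₁₂_apply, LinearMap.mul_apply', AlgHom.toLinearMap_apply, inr_t_mul_inl T,
    LinearMap.applyₗ_apply_apply, LinearMap.flip_apply, LinearMap.id_apply, mk_apply]
  have h1 : ∀ (u v w : H), biHit k H u v (biHit k H 1 w f) = biHit k H u (w * v) f := by
    intro u v w; ext; simp [mul_assoc]
  simp only [h1]
  rw [Finset.sum_comm]
  refine Finset.sum_congr rfl fun a _ => ?_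
  rw [Finset.sum_comm, Finset.sum_eq_single j]
  · simp only [← mk_apply, ← LinearMap.flip_apply (mk k H), ← map_sum]
    rw [← LinearMap.sum_apply, ← map_sum, mul_Si, if_pos rfl]
  · intro b _ hb
    simp only [← mk_apply, ← LinearMap.flip_apply (mk k H), ← map_sum]
    rw [← LinearMap.sum_apply, ← map_sum, mul_Si, if_neg hb]
    simp
  · simp

/-- `Δᵒᵖ(f) R = R Δ(f)` for `f` in `H^*`: both sides are `∑ᵢ B(Δ bᵢ) ⊗ βᵢ`, where `B` is either of
the two bilinear maps compared in `mul_biHit_comul`. -/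
theorem comul_op_inl_mul (f : HopfDual k H) :
    TensorProduct.comm k _ _ (comul (inl k H f)) * universalR k H =
      universalR k H * comul (inl k H f) := by
  obtain ⟨n, ⟨T⟩⟩ := exists_coeff (k := k) (C := H)
  have hL : TensorProduct.comm k _ _ (comul (inl k H f)) * universalR k H =
      ∑ i, ∑ j, tmul (biHit k H (T.b i) 1 f) (T.b j) ⊗ₜ[k]
        inl k H (dualBasis T i * dualBasis T j) := by
    rw [comul_inl, comul_eq_sum_tmul_dualBasis T, universalR_eq_sum T]
    simp only [map_sum, TensorProduct.comm_tmul, TensorProduct.map_tmul, Finset.sum_mul_sum,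
      Algebra.TensorProduct.tmul_mul_tmul, AlgHom.toLinearMap_apply, inl_mul_inr, map_mul]
  have hR : universalR k H * comul (inl k H f) =
      ∑ i, ∑ j, (inr k H (T.b i) * inl k H (biHit k H 1 (T.b j) f)) ⊗ₜ[k]
        inl k H (dualBasis T i * dualBasis T j) := by
    rw [comul_inl, comul_eq_sum_dualBasis_tmul T, universalR_eq_sum T]
    simp only [map_sum, TensorProduct.comm_tmul, TensorProduct.map_tmul, Finset.sum_mul_sum,
      Algebra.TensorProduct.tmul_mul_tmul, AlgHom.toLinearMap_apply, map_mul]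
  rw [hL, hR]
  refine (sum_comul_tmul T ((TensorProduct.mk k _ _).compl₁₂
    (TensorProduct.lift ((mk k H).compl₁₂ (LinearMap.applyₗ f ∘ₗ (biHit k H).flip 1)
      LinearMap.id)) (inl k H).toLinearMap)).symm.trans
    (Eq.trans ?_ (sum_comul_tmul T ((TensorProduct.mk k _ _).compl₁₂
    (TensorProduct.lift ((LinearMap.mul k (DrinfeldDouble k H)).compl₁₂ (inr k H).toLinearMap
      ((inl k H).toLinearMap ∘ₗ (LinearMap.applyₗ f ∘ₗ biHit k H 1)))) (inl k H).toLinearMap)))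
  simp only [LinearMap.compl₁₂_apply, mul_biHit_comul]

/-- `Δᵒᵖ(h) R = R Δ(h)` for `h` in `H`, that is,
`∑ h₄ bᵢ ⊗ (h₁ ⇀ βᵢ ↼ S⁻¹ h₃) h₂ = ∑ bᵢ h₁ ⊗ βᵢ h₂`. Moving the two actions from `βᵢ` to `bᵢ`
produces the product `h₄ S⁻¹(h₃)`, which collapses to the counit. -/
theorem comul_op_inr_mul (h : H) :
    TensorProduct.comm k _ _ (comul (inr k H h)) * universalR k H =
      universalR k H * comul (inr k H h) := by
  obtain ⟨n, ⟨T⟩⟩ := exists_coeff (k := k) (C := H)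
  suffices e : LinearMap.mulRight k (universalR k H) ∘ₗ (TensorProduct.comm k _ _).toLinearMap ∘ₗ
        comul ∘ₗ (inr k H).toLinearMap =
      LinearMap.mulLeft k (universalR k H) ∘ₗ comul ∘ₗ (inr k H).toLinearMap from
    LinearMap.congr_fun e h
  refine T.ext fun i j => ?_
  change TensorProduct.comm k _ _ (comul (inr k H (T.t i j))) * universalR k H =
    universalR k H * comul (inr k H (T.t i j))
  -- `h₁` and `S⁻¹ h₃` are moved from the dual basis to the basis.
  have ht : ∀ u a c v : H, ∑ p, inr k H (u * T.b p) ⊗ₜ[k] tmul (biHit k H a c (dualBasis T p)) v =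
      ∑ p, inr k H (u * (c * (T.b p * a))) ⊗ₜ[k] tmul (dualBasis T p) v := fun u a c v =>
    (sum_transpose T ((TensorProduct.mk k _ _).flip.compl₁₂ ((mk k H).flip v)
      ((inr k H).toLinearMap ∘ₗ LinearMap.mulLeft k u))
        (LinearMap.mulLeft k c ∘ₗ LinearMap.mulRight k a)).symm
  simp only [AlgHom.toLinearMap_apply, comul_inr, T.comul_t, map_sum,
    TensorProduct.map_tmul, TensorProduct.comm_tmul, universalR_eq_sum T, Finset.sum_mul_sum,
    Algebra.TensorProduct.tmul_mul_tmul, inl_mul_inr]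
  calc _ = ∑ l, ∑ a, ∑ b, ∑ p, inr k H (T.t l j * T.b p) ⊗ₜ[k]
        tmul (biHit k H (T.t i a) (antipodeInv k H (T.t b l)) (dualBasis T p)) (T.t a b) := by
        refine Finset.sum_congr rfl fun l _ => ?_
        simp only [inr_t_mul_inl T, TensorProduct.tmul_sum, map_mul]
        exact Finset.sum_comm.trans (Finset.sum_congr rfl fun _ _ => Finset.sum_comm)
    _ = ∑ a, ∑ b, ∑ p, inr k H ((∑ l, T.t l j * antipodeInv k H (T.t b l)) *
          (T.b p * T.t i a)) ⊗ₜ[k] tmul (dualBasis T p) (T.t a b) := by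
        simp only [ht, Finset.sum_mul, map_sum, TensorProduct.sum_tmul, ← mul_assoc]
        rw [Finset.sum_comm]
        refine Finset.sum_congr rfl fun a _ => ?_
        rw [Finset.sum_comm]
        exact Finset.sum_congr rfl fun b _ => Finset.sum_comm
    _ = ∑ a, ∑ p, (inr k H (T.b p) * inr k H (T.t i a)) ⊗ₜ[k] tmul (dualBasis T p) (T.t a j) := by
        refine Finset.sum_congr rfl fun a _ => ?_
        rw [Finset.sum_eq_single j]
        · simp [mul_Si]
        · intro b _ hb; simp [mul_Si, hb]
        · simp
    _ = _ := Finset.sum_comm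

theorem isQuasitriangular_universalR : IsQuasitriangular (universalR k H) where
  isUnit := isUnit_universalR
  comul_rTensor := comul_rTensor_universalR
  comul_lTensor := comul_lTensor_universalR
  comul_op_mul d := by
    have hcomm : ∀ z w : DrinfeldDouble k H ⊗[k] DrinfeldDouble k H,
        TensorProduct.comm k _ _ (z * w) = TensorProduct.comm k _ _ z * TensorProduct.comm k _ _ w :=
      map_mul (Algebra.TensorProduct.comm k _ _)
    induction d using tmul_induction with
    | h0 => simp
    | ha y w hy hw => simp only [map_add, add_mul, mul_add, hy, hw]
    | ht f h =>
      rw [← inl_mul_inr, Bialgebra.comul_mul, hcomm, mul_assoc, comul_op_inr_mul, ← mul_assoc,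
        comul_op_inl_mul, mul_assoc]

/-! ### Factorizability of the Drinfeld double -/

instance : FiniteDimensional k (DrinfeldDouble k H) :=
  Module.Finite.of_surjective (TensorProduct.lift (mk k H)) fun d => by
    induction d using tmul_induction with
    | h0 => exact ⟨0, map_zero _⟩
    | ht f h => exact ⟨f ⊗ₜ h, by simp⟩
    | ha y w hy hw =>
      obtain ⟨y', rfl⟩ := hy
      obtain ⟨w', rfl⟩ := hw
      exact ⟨y' + w', map_add _ _ _⟩

/-- Here `R₂₁ R = ∑ (βᵢ bⱼ) ⊗ (bᵢ βⱼ)`. -/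
theorem drinfeldMap_universalR (p : Module.Dual k (DrinfeldDouble k H)) :
    drinfeldMap (TensorProduct.comm k _ _ (universalR k H) * universalR k H) p =
      ∑ i, ∑ j, p (tmul (dualBasis T i) (T.b j)) • (inr k H (T.b i) * inl k H (dualBasis T j)) := by
  change TensorProduct.lid k _ (p.rTensor _ _) = _
  simp only [universalR_eq_sum T, map_sum, TensorProduct.comm_tmul, Finset.sum_mul_sum,
    Algebra.TensorProduct.tmul_mul_tmul, inl_mul_inr, LinearMap.rTensor_tmul,
    TensorProduct.lid_tmul]

/-- The products `h f` span `D(H)` because they contain the image of the antipode, so that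
`f ⊗ h ↦ h f` is injective by a dimension count. -/
theorem injective_lift_inr_mul_inl : Function.Injective (TensorProduct.lift
    ((LinearMap.mul k (DrinfeldDouble k H)).flip.compl₁₂ (inl k H).toLinearMap
      (inr k H).toLinearMap)) := by
  -- The two `k`-module structures agree only up to unfolding, hence the explicit equivalence.
  let e : HopfDual k H ⊗[k] H ≃ₗ[k] DrinfeldDouble k H :=
    { toFun := id, invFun := id, map_add' := fun _ _ => rfl, map_smul' := fun _ _ => rfl,
      left_inv := fun _ => rfl, right_inv := fun _ => rfl }
  rw [LinearMap.injective_iff_surjective_of_finrank_eq_finrank e.finrank_eq]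
  intro d
  obtain ⟨d, rfl⟩ := (antipode_bijective (k := k) (H := DrinfeldDouble k H)).2 d
  induction d using tmul_induction with
  | h0 => exact ⟨0, by simp⟩
  | ht f h => exact ⟨transposeInv k H f ⊗ₜ antipode k h, rfl⟩
  | ha y w hy hw =>
    obtain ⟨y', hy'⟩ := hy
    obtain ⟨w', hw'⟩ := hw
    exact ⟨y' + w', by rw [map_add, map_add, hy', hw']⟩

theorem injective_drinfeldMap_universalR : Function.Injective
    (drinfeldMap (TensorProduct.comm k _ _ (universalR k H) * universalR k H)) := by
  obtain ⟨n, ⟨T⟩⟩ := exists_coeff (k := k) (C := H)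
  rw [injective_iff_map_eq_zero]
  intro p hp
  rw [drinfeldMap_universalR T] at hp
  have h1 : ∑ i, ∑ j, p (tmul (dualBasis T i) (T.b j)) • (dualBasis T j ⊗ₜ[k] T.b i) = 0 := by
    apply injective_lift_inr_mul_inl (k := k) (H := H)
    rw [map_zero, ← hp]
    simp
  have h2 : ∀ i j, p (tmul (dualBasis T i) (T.b j)) = 0 := by
    intro i j
    have h := congrArg (HopfDual.evalLeft (T.b j)) h1
    simp only [map_sum, map_smul, HopfDual.evalLeft_tmul, dualBasis_b, map_zero] at h
    refine Fintype.linearIndependent_iff.1 T.b.linearIndependent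
      (fun i => p (tmul (dualBasis T i) (T.b j))) ?_ i
    simpa using h
  refine lin_ext fun f h => ?_
  rw [← sum_smul_dualBasis T f, ← sum_dualBasis_smul T h, ← mk_apply]
  simp [h2, LinearMap.sum_apply]

end DrinfeldDouble

/-! ### The actions of a character on a Hopf algebra -/

section actions
variable {k : Type*} {H : Type*} [Field k] [Ring H] [HopfAlgebra k H] (χ : HopfDual k H)


/-- `rightHit` as a linear map in the acted-upon element. -/
noncomputable def rightHitLin : H →ₗ[k] H :=
  (TensorProduct.lid k H).toLinearMap ∘ₗ (HopfDual.toDual k H χ).rTensor H ∘ₗ comul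

/-- `leftHit` as a linear map in the acted-upon element. -/
noncomputable def leftHitLin : H →ₗ[k] H :=
  (TensorProduct.rid k H).toLinearMap ∘ₗ (HopfDual.toDual k H χ).lTensor H ∘ₗ comul

theorem rightHitLin_apply (h : H) : rightHitLin χ h = rightHit h χ := rfl

theorem leftHitLin_apply (h : H) : leftHitLin χ h = leftHit χ h := rfl

theorem rightHitLin_t {n : ℕ} (T : Coeff k H n) (i j : Fin n) :
    rightHitLin χ (T.t i j) = ∑ l, χ (T.t i l) • T.t l j := by
  simp [rightHitLin, T.comul_t]

theorem leftHitLin_t {n : ℕ} (T : Coeff k H n) (i j : Fin n) :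
    leftHitLin χ (T.t i j) = ∑ l, χ (T.t l j) • T.t i l := by
  simp [leftHitLin, T.comul_t]

theorem mul_apply_eq_rightHit (f : HopfDual k H) (h : H) : (χ * f) h = f (rightHit h χ) := by
  rw [HopfDual.mul_apply, rightHit]
  generalize comul (R := k) h = z
  induction z using TensorProduct.induction_on with
  | zero => simp
  | add y w hy hw => simp only [map_add, hy, hw]
  | tmul u v => simp

theorem mul_apply_eq_leftHit (f : HopfDual k H) (h : H) : (f * χ) h = f (leftHit χ h) := by
  rw [HopfDual.mul_apply, leftHit]
  generalize comul (R := k) h = z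
  induction z using TensorProduct.induction_on with
  | zero => simp
  | add y w hy hw => simp only [map_add, hy, hw]
  | tmul u v => simp [mul_comm]

theorem rightHit_leftHit [FiniteDimensional k H] (h : H) :
    rightHit (leftHit χ h) χ = leftHit χ (rightHit h χ) := by
  obtain ⟨n, ⟨T⟩⟩ := exists_coeff (k := k) (C := H)
  suffices e : rightHitLin χ ∘ₗ leftHitLin χ = leftHitLin χ ∘ₗ rightHitLin χ from
    LinearMap.congr_fun e h
  refine T.ext fun i j => ?_
  simp only [LinearMap.comp_apply, leftHitLin_t χ T, rightHitLin_t χ T, map_sum, map_smul,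
    Finset.smul_sum, smul_smul, mul_comm]
  exact Finset.sum_comm

theorem IsGroupLikeElem.dual_apply_mul [FiniteDimensional k H] {χ : HopfDual k H}
    (hχ : IsGroupLikeElem k χ) (c d : H) : χ (c * d) = χ c * χ d := by
  rw [← HopfDual.evalLeft_comul, hχ.comul_eq_tmul_self, HopfDual.evalLeft_tmul,
    HopfDual.smul_apply]

theorem IsGroupLikeElem.dual_apply_one [FiniteDimensional k H] {χ : HopfDual k H}
    (hχ : IsGroupLikeElem k χ) : χ 1 = 1 := hχ.counit_eq_one

variable {χ}

theorem rightHit_mul_of_isGroupLikeElem [FiniteDimensional k H] (hχ : IsGroupLikeElem k χ)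
    {x : H} (hx : IsGroupLikeElem k x) (h : H) :
    rightHit (h * x) χ = χ x • (rightHit h χ * x) := by
  rw [rightHit, rightHit, Bialgebra.comul_mul, hx.comul_eq_tmul_self]
  generalize comul (R := k) h = z
  induction z using TensorProduct.induction_on with
  | zero => simp
  | add y w hy hw => simp only [map_add, add_mul, smul_add, hy, hw]
  | tmul u v => simp [hχ.dual_apply_mul, smul_smul, mul_comm]

theorem rightHit_mul_left_of_isGroupLikeElem [FiniteDimensional k H] (hχ : IsGroupLikeElem k χ)
    {x : H} (hx : IsGroupLikeElem k x) (h : H) :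
    rightHit (x * h) χ = χ x • (x * rightHit h χ) := by
  rw [rightHit, rightHit, Bialgebra.comul_mul, hx.comul_eq_tmul_self]
  generalize comul (R := k) h = z
  induction z using TensorProduct.induction_on with
  | zero => simp
  | add y w hy hw => simp only [map_add, mul_add, smul_add, hy, hw]
  | tmul u v => simp [hχ.dual_apply_mul, smul_smul]

theorem leftHit_mul_of_isGroupLikeElem [FiniteDimensional k H] (hχ : IsGroupLikeElem k χ)
    {x : H} (hx : IsGroupLikeElem k x) (h : H) :
    leftHit χ (h * x) = χ x • (leftHit χ h * x) := by
  rw [leftHit, leftHit, Bialgebra.comul_mul, hx.comul_eq_tmul_self]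
  generalize comul (R := k) h = z
  induction z using TensorProduct.induction_on with
  | zero => simp
  | add y w hy hw => simp only [map_add, add_mul, smul_add, hy, hw]
  | tmul u v => simp [hχ.dual_apply_mul, smul_smul, mul_comm]

/-- The intertwining relation `x (χ ⇀ h) = (h ↼ χ) x`. On the given basis it says that
`σ τ⁻¹ σ⁻¹ = τ⁻¹`, and `σ` and `τ` commute because the two actions of `χ` do. -/
theorem mul_leftHit_eq_rightHit_mul [FiniteDimensional k H] (hχ : IsGroupLikeElem k χ)
    {x : H} (hx : IsGroupLikeElem k x) {ι κ : Type*} {e : κ → ℕ} {a : ι → H}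
    (ha : Function.Injective a) (σ τ : Equiv.Perm ι) (hσ : ∀ i, x * a i = a (σ i) * x)
    (hspan : Submodule.span k (Set.range fun p : ι × κ => a p.1 * x ^ e p.2) = ⊤)
    (hτ : ∀ i, rightHit (a i) χ = a (τ⁻¹ i))
    (hτσ : ∀ i, leftHit χ (a i) = a (τ⁻¹ (σ⁻¹ i))) (h : H) :
    x * leftHit χ h = rightHit h χ * x := by
  have hcomm : ∀ i, σ⁻¹ (τ⁻¹ i) = τ⁻¹ (σ⁻¹ i) := by
    intro i
    have := rightHit_leftHit χ (a i)
    rw [hτσ, hτ, hτ, hτσ] at this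
    exact (τ⁻¹.injective (ha this)).symm
  suffices e : LinearMap.mulLeft k x ∘ₗ leftHitLin χ = LinearMap.mulRight k x ∘ₗ rightHitLin χ from
    LinearMap.congr_fun e h
  refine LinearMap.ext_on_range hspan ?_
  rintro ⟨i, j⟩
  simp only [LinearMap.comp_apply, LinearMap.mulLeft_apply, LinearMap.mulRight_apply,
    leftHitLin_apply, rightHitLin_apply, leftHit_mul_of_isGroupLikeElem hχ (hx.pow),
    rightHit_mul_of_isGroupLikeElem hχ (hx.pow), hτ, hτσ]
  rw [mul_smul_comm, smul_mul_assoc, ← mul_assoc, hσ, ← hcomm, Equiv.Perm.inv_def σ,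
    Equiv.apply_symm_apply, mul_assoc, mul_assoc, ← pow_succ, ← pow_succ']

end actions

/-! ### The central group-like element `χx` -/

namespace DrinfeldDouble
variable {k : Type*} {H : Type*} [Field k] [Ring H] [HopfAlgebra k H] [FiniteDimensional k H]
variable {χ : HopfDual k H} {x : H}

theorem isGroupLikeElem_tmul (hχ : IsGroupLikeElem k χ) (hx : IsGroupLikeElem k x) :
    IsGroupLikeElem k (tmul χ x) where
  counit_eq_one := by rw [counit_tmul, hx.counit_eq_one, hχ.dual_apply_one, one_mul]
  comul_eq_tmul_self := by
    rw [comul_tmul, hχ.comul_eq_tmul_self, hx.comul_eq_tmul_self, shuffle_tmul]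

/-- In `D(H)` one has `h χ = χ (χ⁻¹ ⇀ h ↼ χ)`, and the relation `x (χ ⇀ h) = (h ↼ χ) x` turns
`(χ⁻¹ ⇀ h ↼ χ) x` into `x h`. -/
theorem commute_inr_tmul (hχ : IsGroupLikeElem k χ)
    (hrel : ∀ h, x * leftHit χ h = rightHit h χ * x) (h : H) :
    inr k H h * tmul χ x = tmul χ x * inr k H h := by
  obtain ⟨n, ⟨T⟩⟩ := exists_coeff (k := k) (C := H)
  suffices e : LinearMap.mulRight k (tmul χ x) ∘ₗ (inr k H).toLinearMap =
      LinearMap.mulLeft k (tmul χ x) ∘ₗ (inr k H).toLinearMap from LinearMap.congr_fun e h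
  refine T.ext fun i j => ?_
  change tmul 1 (T.t i j) * tmul χ x = tmul χ x * tmul 1 (T.t i j)
  rw [mul_one_tmul, mul_t_tmul T]
  have hb : ∀ u v, biHit k H u v χ = (χ u * χ v) • χ := by
    intro u v; ext d; simp [hχ.dual_apply_mul]; ring
  calc _ = tmul χ (∑ b, χ (antipodeInv k H (T.t b j)) • ((∑ a, χ (T.t i a) • T.t a b) * x)) := by
        simp only [one_mul, hb, Finset.sum_mul, Finset.smul_sum, ← mk_apply, map_sum, map_smul,
          LinearMap.smul_apply, smul_mul_assoc, smul_smul]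
        rw [Finset.sum_comm]
        simp only [mul_comm]
    _ = tmul χ (x * ∑ l, χ (∑ b, antipodeInv k H (T.t b j) * T.t l b) • T.t i l) := by
        simp only [← rightHitLin_t χ T, rightHitLin_apply, ← hrel]
        simp only [← leftHitLin_apply, leftHitLin_t χ T, Finset.mul_sum, Finset.smul_sum,
          Finset.sum_smul, map_sum, hχ.dual_apply_mul, mul_smul_comm, smul_smul]
        rw [Finset.sum_comm]
    _ = _ := by
        simp only [Si_mul]
        rw [Finset.sum_eq_single j]
        · simp [hχ.dual_apply_one]
        · intro l _ hl; simp [hl]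
        · simp

theorem inr_mul_inl_of_isGroupLikeElem (hx : IsGroupLikeElem k x) (f : HopfDual k H) :
    inr k H x * inl k H f = tmul (biHit k H x (antipode k x) f) x := by
  have hS : antipodeInv k H x = antipode k x := by
    apply antipode_injective (k := k) (H := H)
    rw [antipode_antipodeInv, hx.antipode_antipode]
  have e : mulMap k H (1 ⊗ₜ x) (f ⊗ₜ 1) = biHit k H x (antipode k x) f ⊗ₜ x := by
    rw [mulMap_tmul, leftAct, LinearMap.comp_apply, LinearMap.comp_apply, hx.comul_eq_tmul_self,
      LinearMap.lTensor_tmul, hx.comul_eq_tmul_self, tripleAct_tmul, hS]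
    simp
  exact e

/-- The intertwining relation gives commutation with `H`, and, evaluated against functionals, also
commutation with `H^*`, because `x f = (x ⇀ f ↼ x⁻¹) x`. -/
theorem tmul_mem_center (hχ : IsGroupLikeElem k χ) (hx : IsGroupLikeElem k x)
    (hrel : ∀ h, x * leftHit χ h = rightHit h χ * x) :
    tmul χ x ∈ Subalgebra.center k (DrinfeldDouble k H) := by
  have hl : ∀ f, inl k H f * tmul χ x = tmul χ x * inl k H f := by
    intro f
    rw [← inl_mul_inr, mul_assoc, inr_mul_inl_of_isGroupLikeElem hx, ← mul_assoc, ← map_mul,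
      ← inl_mul_inr, ← mul_assoc, ← map_mul]
    congr 2
    ext h
    rw [mul_apply_eq_leftHit, mul_apply_eq_rightHit, biHit_apply, ← hrel, ← mul_assoc,
      hx.antipode_mul_cancel, one_mul]
  refine Subalgebra.mem_center_iff.2 fun d => ?_
  induction d using tmul_induction with
  | h0 => simp
  | ha y w hy hw => rw [add_mul, mul_add, hy, hw]
  | ht f h =>
    rw [← inl_mul_inr f h, mul_assoc, commute_inr_tmul hχ hrel, ← mul_assoc, hl, mul_assoc]

variable (χ x) in
/-- The map `f ⊗ h ↦ (x ⇀ f) ⊗ (h ↼ χ)`: the action on `D(H)` of the character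
`f ⊗ h ↦ f(x) χ(h)`, whose image under the Drinfeld map is `χx`. -/
noncomputable def characterAct : Module.End k (DrinfeldDouble k H) :=
  TensorProduct.lift ((mk k H).compl₁₂ (biHit k H x 1) (rightHitLin χ))

theorem characterAct_tmul (f : HopfDual k H) (h : H) :
    characterAct χ x (tmul f h) = tmul (biHit k H x 1 f) (rightHit h χ) := rfl

/-- Moving the actions of `x` and `χ` from one tensor leg of `R₂₁ R` to the other turns
`bᵢ βⱼ` into `bᵢ (x χ) βⱼ`. -/
theorem drinfeldMap_comp_characterAct
    (hc : tmul χ x ∈ Subalgebra.center k (DrinfeldDouble k H))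
    (hcomm : inr k H x * inl k H χ = tmul χ x) (p : Module.Dual k (DrinfeldDouble k H)) :
    drinfeldMap (TensorProduct.comm k _ _ (universalR k H) * universalR k H)
        (p ∘ₗ characterAct χ x) =
      tmul χ x *
        drinfeldMap (TensorProduct.comm k _ _ (universalR k H) * universalR k H) p := by
  obtain ⟨n, ⟨T⟩⟩ := exists_coeff (k := k) (C := H)
  rw [drinfeldMap_universalR T, drinfeldMap_universalR T]
  simp only [LinearMap.comp_apply, characterAct_tmul]
  calc _ = ∑ i, ∑ j, p (tmul (biHit k H x 1 (dualBasis T i)) (T.b j)) •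
        (inr k H (T.b i) * inl k H (χ * dualBasis T j)) := by
        refine Finset.sum_congr rfl fun i _ => ?_
        have hj : ∀ j, χ * dualBasis T j = (HopfDual.toDual k H).symm
            (HopfDual.toDual k H (dualBasis T j) ∘ₗ rightHitLin χ) := by
          intro j; ext h; exact mul_apply_eq_rightHit χ _ h
        simp only [hj]
        exact sum_transpose T ((LinearMap.lsmul k _).flip.compl₁₂
          (LinearMap.mulLeft k (inr k H (T.b i)) ∘ₗ (inl k H).toLinearMap)
          (p ∘ₗ mk k H (biHit k H x 1 (dualBasis T i)))) (rightHitLin χ)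
    _ = ∑ i, ∑ j, p (tmul (dualBasis T i) (T.b j)) •
        (inr k H (T.b i * x) * inl k H (χ * dualBasis T j)) := by
        have hi : ∀ i, biHit k H x 1 (dualBasis T i) = (HopfDual.toDual k H).symm
            (HopfDual.toDual k H (dualBasis T i) ∘ₗ LinearMap.mulRight k x) := by
          intro i; ext h; simp
        simp only [hi]
        rw [Finset.sum_comm]
        conv_rhs => rw [Finset.sum_comm]
        refine Finset.sum_congr rfl fun j _ => ?_
        exact (sum_transpose T ((LinearMap.lsmul k _).compl₁₂ (p ∘ₗ (mk k H).flip (T.b j))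
          (LinearMap.mulRight k (inl k H (χ * dualBasis T j)) ∘ₗ (inr k H).toLinearMap))
            (LinearMap.mulRight k x)).symm
    _ = _ := by
        simp only [Finset.mul_sum, mul_smul_comm]
        refine Finset.sum_congr rfl fun i _ => Finset.sum_congr rfl fun j _ => ?_
        rw [map_mul, map_mul, mul_assoc, ← mul_assoc (inr k H x), hcomm, ← mul_assoc,
          Subalgebra.mem_center_iff.1 hc, mul_assoc]

theorem inr_mul_inl_comm (hχ : IsGroupLikeElem k χ) (hx : IsGroupLikeElem k x) :
    inr k H x * inl k H χ = tmul χ x := by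
  rw [inr_mul_inl_of_isGroupLikeElem hx]
  congr 1
  ext h
  rw [biHit_apply, hχ.dual_apply_mul, hχ.dual_apply_mul, mul_comm, mul_assoc, ← hχ.dual_apply_mul,
    hx.mul_antipode_cancel, hχ.dual_apply_one, mul_one]

theorem characterAct_tmul_mul (hχ : IsGroupLikeElem k χ) (hx : IsGroupLikeElem k x)
    (hc : tmul χ x ∈ Subalgebra.center k (DrinfeldDouble k H)) (d : DrinfeldDouble k H) :
    characterAct χ x (tmul χ x * d) = χ x ^ 2 • (tmul χ x * characterAct χ x d) := by
  have hmul : ∀ f h, tmul χ x * tmul f h = tmul (f * χ) (x * h) := by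
    intro f h
    rw [← inl_mul_inr f h, ← mul_assoc, ← Subalgebra.mem_center_iff.1 hc, ← inl_mul_inr χ x,
      ← mul_assoc, ← map_mul, mul_assoc, ← map_mul, inl_mul_inr]
  have hb : ∀ f, biHit k H x 1 (f * χ) = χ x • (biHit k H x 1 f * χ) := by
    intro f
    ext h
    rw [biHit_apply, HopfDual.smul_apply, mul_apply_eq_leftHit, mul_apply_eq_leftHit, one_mul,
      leftHit_mul_of_isGroupLikeElem hχ hx, biHit_apply, one_mul, map_smul, smul_eq_mul]
  induction d using tmul_induction with
  | h0 => simp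
  | ha y w hy hw => rw [mul_add, map_add, hy, hw, map_add, mul_add, smul_add]
  | ht f h =>
    rw [hmul, characterAct_tmul, characterAct_tmul, hmul, hb,
      rightHit_mul_left_of_isGroupLikeElem hχ hx, smul_tmul, ← mk_apply, map_smul, mk_apply,
      smul_smul, sq]

theorem tmul_pow (hc : tmul χ x ∈ Subalgebra.center k (DrinfeldDouble k H)) (j : ℕ) :
    tmul χ x ^ j = tmul (χ ^ j) (x ^ j) := by
  induction j with
  | zero => simp only [pow_zero]; rfl
  | succ j ih =>
    rw [pow_succ', ih, ← inl_mul_inr (χ ^ j), ← mul_assoc, ← Subalgebra.mem_center_iff.1 hc,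
      ← inl_mul_inr χ x, ← mul_assoc, ← map_mul, mul_assoc, ← map_mul, inl_mul_inr, ← pow_succ,
      ← pow_succ']

end DrinfeldDouble

theorem theorem3p1 {k : Type*} [Field k] [IsAlgClosed k] [CharZero k]
    {H : Type*} [Ring H] [HopfAlgebra k H] [FiniteDimensional k H]
    {n m : ℕ} (hn : Odd n)
    (x : H) (hx : IsGroupLikeElem k x) (hxn : orderOf x = n)
    (a : Fin m → H)
    (χ : HopfDual k H) (hχ : IsGroupLikeElem k χ)
    (σ τ : Equiv.Perm (Fin m))
    (hσ : ∀ i, x * a i = a (σ i) * x)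
    (hli : LinearIndependent k fun p : Fin m × Fin n => a p.1 * x ^ ((p.2 : ℕ) + 1))
    (hspan : Submodule.span k
      (Set.range fun p : Fin m × Fin n => a p.1 * x ^ ((p.2 : ℕ) + 1)) = ⊤)
    (hτ : ∀ i, rightHit (a i) χ = a (τ⁻¹ i))
    (hτσ : ∀ i, leftHit χ (a i) = a (τ⁻¹ (σ⁻¹ i)))
    (hω : IsPrimitiveRoot (χ x) n) (hχn : orderOf χ = n) :
    let g : DrinfeldDouble k H := DrinfeldDouble.tmul χ x
    let K : Subalgebra k (DrinfeldDouble k H) := groupLikeAlgebra k g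
    let I : Ideal (DrinfeldDouble k H) := augmentationIdeal K
    IsGroupLikeElem k g ∧
      g ∈ Subalgebra.center k (DrinfeldDouble k H) ∧
      IsNormalHopfSubalgebra K ∧
      ∃ (_ : I.IsTwoSided) (_ : I.IsHopfIdeal k),
        IsFactorizable (A := DrinfeldDouble k H ⧸ I)
          (TensorProduct.map (Ideal.Quotient.mkₐ k I).toLinearMap
            (Ideal.Quotient.mkₐ k I).toLinearMap (DrinfeldDouble.universalR k H)) := by
  intro g K I
  have hn0 : n ≠ 0 := hn.pos.ne'
  have : NeZero n := ⟨hn0⟩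
  have ha : Function.Injective a := by
    intro i j hij
    have h := hli.injective (a₁ := (i, 0)) (a₂ := (j, 0)) (by simp [hij])
    exact congrArg Prod.fst h
  have hrel := mul_leftHit_eq_rightHit_mul (e := fun j : Fin n => (j : ℕ) + 1) hχ hx ha σ τ hσ
    hspan hτ hτσ
  have hg : IsGroupLikeElem k g := DrinfeldDouble.isGroupLikeElem_tmul hχ hx
  have hc : g ∈ Subalgebra.center k (DrinfeldDouble k H) :=
    DrinfeldDouble.tmul_mem_center hχ hx hrel
  have hgn : g ^ n = 1 := by
    rw [DrinfeldDouble.tmul_pow hc, ← hχn, pow_orderOf_eq_one, hχn, ← hxn, pow_orderOf_eq_one]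
    rfl
  have htwo : I.IsTwoSided := hg.isTwoSided_augmentationIdeal hc
  have hhopf : I.IsHopfIdeal k := hg.isHopfIdeal_augmentationIdeal
  refine ⟨hg, hc, hg.isHopfSubalgebra.isNormal (hg.groupLikeAlgebra_le_center hc), htwo, hhopf, ?_⟩
  -- The scaling factor is `χ(x) ^ 2`, which is a primitive `n`-th root of unity as `n` is odd.
  exact hg.isFactorizable_quotient hc hn0 hgn DrinfeldDouble.isQuasitriangular_universalR
    DrinfeldDouble.injective_drinfeldMap_universalR (DrinfeldDouble.characterAct χ x)
    (DrinfeldDouble.drinfeldMap_comp_characterAct hc (DrinfeldDouble.inr_mul_inl_comm hχ hx))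
    (hω.pow_of_coprime 2 hn.coprime_two_left) (DrinfeldDouble.characterAct_tmul_mul hχ hx hc)
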